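/- Let $\mathbb T=\mathbb R/2\pi\mathbb Z$. Write $f_j=\frac1{2\pi}\int_{\mathbb T}e^{-ijy}f(y)\,dy$, and let all $L^2$ norms be taken with respect to the normalised measure, so that $\|f\|_{L^2(\mathbb T)}^2=\frac1{2\pi}\int_{\mathbb T}|f|^2\,dy=\sum_j|f_j|^2$ and $\|f\|_{H^3}^2=\sum_j(1+j^2)^3|f_j|^2$. For a mean-free $f$, $\partial_y^{-1}f$ denotes its mean-free antiderivative. For $\nu,\alpha>0$ and real $U\in H^3(\mathbb T)$ let $\Delta_\alpha=\partial_{yy}+\alpha^2\partial_{xx}$ and consider on $L^2(\mathbb T^2)$ the Orr–Sommerfeld operator $$\mathcal L_{\nu,\alpha}=\nu\Delta_\alpha-\alpha\,\partial_x\big(U(y)-U''(y)\Delta_\alpha^{-1}\big),\qquad D(\mathcal L_{\nu,\alpha})=H^2(\mathbb T^2).$$ **Theorem.** Let $U\in H^3(\mathbb T)$ be real-valued with zero mean. There are constants $\delta_0\in(0,1)$ and $C\ge1$, depending only on (an upper bound for) $\|U\|_{H^3}$, such that for all $\nu,\alpha>0$ and $k\in\mathbb Z\setminus\{0\}$ with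 $$\|\partial_y^{-1}U\|_{L^2}>\nu\qquad\text{and}\qquad \alpha|k|\le\delta_0\nu$$ the following holds for the operator $\mathcal L_{\nu,\alpha}$ restricted to the class $\{e^{ikx}f(y):f\in L^2(\mathbb T)\}$. It has an algebraically simple eigenvalue $\lambda$ with $\operatorname{Re}\lambda>-\nu/2$ and an eigenfunction $e^{ikx}V(y)$, unique up to scalar multiples, such that $$\Big|\lambda-\frac{(\alpha k)^2}{\nu}\big(\|\partial_y^{-1}U\|_{L^2}^2-\nu^2\big)\Big|\le C\,\frac{(\alpha|k|)^3}{\nu^2},\qquad \|V-U\|_{L^2}\le C\,\frac{\alpha|k|}{\nu}.$$ The rest of the spectrum in this class is pure point (it consists of eigenvalues) and is contained in $\{\operatorname{Re}z\le-\nu/2\}$. In particular $\lambda$ is the only possible unstable point of the spectrum, and it is unstable, $\operatorname{Re}\lambda>0$, as soon as $C\,\alpha|k|/\nu<\|\partial_y^{-1}U\|_{L^2}^2-\nu^2$ (thus, for given $U$ and $\nu<\|\partial_y^{-1}U\|_{L^2}$, for all sufficiently small $\alpha|k|$). -/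

import Mathlib

open MeasureTheory AddCircle

noncomputable section

namespace OrrSommerfeld

/-! ### The torus, its normalised measure, and `L²` -/

instance fact_two_pi_pos : Fact (0 < 2 * Real.pi) := ⟨Real.two_pi_pos⟩

/-- The torus `𝕋 = ℝ / 2πℤ`. -/
abbrev Torus : Type := AddCircle (2 * Real.pi)

/-- The normalised measure `dy / 2π` on `𝕋`.  All `L²` norms are taken with respect to it, so
that Parseval's identity reads `‖f‖² = ∑ |f_j|²`. -/
abbrev tmeas : Measure Torus := haarAddCircle

/-- The normalised measure on `𝕋 × 𝕋`. -/
abbrev tmeas2 : Measure (Torus × Torus) := tmeas.prod tmeas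

/-- `L²(𝕋; ℂ)`. -/
abbrev L2T : Type := Lp ℂ 2 tmeas

/-- `L²(𝕋²; ℂ)`, with variables `(x, y)`. -/
abbrev L2T2 : Type := Lp ℂ 2 tmeas2

/-! ### Functions of one variable: Sobolev norms, `∂_y²`, `∂_y⁻¹` -/

/-- `f ∈ H^s(𝕋)`. -/
def MemH (s : ℕ) (f : L2T) : Prop :=
  Summable fun j : ℤ => (1 + (j : ℝ) ^ 2) ^ s * ‖fourierCoeff f j‖ ^ 2

/-- The `H^s(𝕋)` norm (meaningful when `MemH s f`). -/
def normH (s : ℕ) (f : L2T) : ℝ :=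
  Real.sqrt (∑' j : ℤ, (1 + (j : ℝ) ^ 2) ^ s * ‖fourierCoeff f j‖ ^ 2)

open Classical in
/-- The element of `L²(𝕋)` whose Fourier coefficients are a given square-summable family
(zero if the family is not square-summable). -/
def ofCoeff (a : ℤ → ℂ) : L2T :=
  if h : Memℓp a 2 then
    (fourierBasis (T := 2 * Real.pi)).repr.symm (⟨a, h⟩ : lp (fun _ : ℤ => ℂ) 2)
  else 0

theorem fourierCoeff_ofCoeff {a : ℤ → ℂ} (h : Memℓp a 2) (j : ℤ) :
    fourierCoeff (ofCoeff a) j = a j := by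
  rw [← fourierBasis_repr, ofCoeff, dif_pos h, LinearIsometryEquiv.apply_symm_apply]

/-- The second derivative `f''`, for `f ∈ H²(𝕋)`: Fourier coefficients `-j² f_j`. -/
def deriv2 (f : L2T) : L2T := ofCoeff fun j => -((j : ℂ) ^ 2) * fourierCoeff f j

/-- The mean-free antiderivative `∂_y⁻¹ f` of a mean-free `f`: Fourier coefficients
`f_j / (i j)` for `j ≠ 0`, and `0` for `j = 0`. -/
def antideriv (f : L2T) : L2T :=
  ofCoeff fun j => if j = 0 then 0 else fourierCoeff f j / (Complex.I * (j : ℂ))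

/-! ### Functions of two variables -/

/-- The Fourier coefficient of index `(m, n)` of a function on `𝕋²`, i.e. the normalised integral
of `e^{-imx} e^{-iny} f(x, y)`. -/
def coeff2 (f : Torus × Torus → ℂ) (m n : ℤ) : ℂ :=
  ∫ p, (fourier (-m) p.1 * fourier (-n) p.2) * f p ∂tmeas2

/-- `w ∈ H²(𝕋²)`. -/
def MemH2T2 (w : L2T2) : Prop :=
  Summable fun q : ℤ × ℤ => (1 + (q.1 : ℝ) ^ 2 + (q.2 : ℝ) ^ 2) ^ 2 * ‖coeff2 w q.1 q.2‖ ^ 2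

/-- The Fourier symbol of `Δ_α = ∂_yy + α² ∂_xx`. -/
def lapSymbol (α : ℝ) (m n : ℤ) : ℂ := -(((α * m) ^ 2 + (n : ℝ) ^ 2 : ℝ) : ℂ)

/-- `ψ = Δ_α⁻¹ w`: the mean-free `ψ ∈ L²(𝕋²)` with `Δ_α ψ = w` up to the mean of `w`. -/
def IsStream (α : ℝ) (w ψ : L2T2) : Prop :=
  coeff2 ψ 0 0 = 0 ∧
    ∀ m n : ℤ, (m, n) ≠ (0, 0) → lapSymbol α m n * coeff2 ψ m n = coeff2 w m n

theorem integrable_fourier_mul {f : Torus × Torus → ℂ} (hf : Integrable f tmeas2) (m n : ℤ) :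
    Integrable (fun p => (fourier (-m) p.1 * fourier (-n) p.2) * f p) tmeas2 := by
  refine hf.bdd_mul (c := 1) ?_ (Filter.Eventually.of_forall fun p => ?_)
  · exact (Continuous.aestronglyMeasurable (by fun_prop))
  · simp only [fourier_apply, norm_mul, Circle.norm_coe, mul_one, le_refl]

theorem coeff2_add {f g : Torus × Torus → ℂ} (hf : Integrable f tmeas2)
    (hg : Integrable g tmeas2) (m n : ℤ) :
    coeff2 (f + g) m n = coeff2 f m n + coeff2 g m n := by
  unfold coeff2
  rw [← integral_add (integrable_fourier_mul hf m n) (integrable_fourier_mul hg m n)]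
  simp [mul_add]

theorem coeff2_smul (c : ℂ) (f : Torus × Torus → ℂ) (m n : ℤ) :
    coeff2 (c • f) m n = c * coeff2 f m n := by
  unfold coeff2
  rw [← integral_const_mul]
  congr 1
  funext p
  simp only [Pi.smul_apply, smul_eq_mul]
  ring

theorem coeff2_congr {f g : Torus × Torus → ℂ} (h : f =ᵐ[tmeas2] g) (m n : ℤ) :
    coeff2 f m n = coeff2 g m n :=
  integral_congr_ae (by filter_upwards [h] with p hp; rw [hp])

theorem L2T2.integrable (w : L2T2) : Integrable w tmeas2 :=
  (Lp.memLp w).integrable (by norm_num)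

theorem coeff2_coe_add (v w : L2T2) (m n : ℤ) :
    coeff2 (v + w : L2T2) m n = coeff2 v m n + coeff2 w m n := by
  rw [coeff2_congr (Lp.coeFn_add v w), coeff2_add (L2T2.integrable v) (L2T2.integrable w)]

theorem coeff2_coe_smul (c : ℂ) (w : L2T2) (m n : ℤ) :
    coeff2 (c • w : L2T2) m n = c * coeff2 w m n := by
  rw [coeff2_congr (Lp.coeFn_smul c w), coeff2_smul]

theorem coeff2_coe_zero (m n : ℤ) : coeff2 (0 : L2T2) m n = 0 := by
  simpa using coeff2_coe_smul 0 0 m n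

/-- `(x, y) ↦ U(y) w(x, y) - W(y) ψ(x, y)`. -/
def transport (U W : L2T) (w ψ : L2T2) : Torus × Torus → ℂ :=
  fun p => U p.2 * w p - W p.2 * ψ p

theorem integrable_snd_mul (U : L2T) (w : L2T2) :
    Integrable (fun p : Torus × Torus => U p.2 * w p) tmeas2 :=
  ((Lp.memLp U).comp_snd tmeas).integrable_mul (Lp.memLp w)

theorem integrable_transport (U W : L2T) (w ψ : L2T2) :
    Integrable (transport U W w ψ) tmeas2 :=
  (integrable_snd_mul U w).sub (integrable_snd_mul W ψ)

theorem transport_add (U W : L2T) (w w' ψ ψ' : L2T2) :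
    transport U W (w + w') (ψ + ψ') =ᵐ[tmeas2] transport U W w ψ + transport U W w' ψ' := by
  filter_upwards [Lp.coeFn_add w w', Lp.coeFn_add ψ ψ'] with p h h'
  simp only [transport, Pi.add_apply, h, h']
  ring

theorem transport_smul (U W : L2T) (c : ℂ) (w ψ : L2T2) :
    transport U W (c • w) (c • ψ) =ᵐ[tmeas2] c • transport U W w ψ := by
  filter_upwards [Lp.coeFn_smul c w, Lp.coeFn_smul c ψ] with p h h'
  simp only [transport, Pi.smul_apply, smul_eq_mul, h, h']
  ring

theorem MemH2T2.add {v w : L2T2} (hv : MemH2T2 v) (hw : MemH2T2 w) : MemH2T2 (v + w) := by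
  refine Summable.of_nonneg_of_le (fun q => by positivity) (fun q => ?_)
    ((Summable.add hv hw).mul_left 2)
  rw [coeff2_coe_add, ← mul_add, mul_left_comm]
  refine mul_le_mul_of_nonneg_left ?_ (by positivity)
  have h := norm_add_le (coeff2 v q.1 q.2) (coeff2 w q.1 q.2)
  nlinarith [sq_nonneg (‖coeff2 v q.1 q.2‖ - ‖coeff2 w q.1 q.2‖),
    norm_nonneg (coeff2 v q.1 q.2 + coeff2 w q.1 q.2)]

theorem MemH2T2.smul (c : ℂ) {w : L2T2} (hw : MemH2T2 w) : MemH2T2 (c • w) := by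
  refine (hw.mul_left (‖c‖ ^ 2)).congr fun q => ?_
  rw [coeff2_coe_smul, norm_mul]
  ring

/-! ### The Orr–Sommerfeld operator on `L²(𝕋²)` -/

/-- The graph of `𝓛_{ν,α} = ν Δ_α - α ∂_x (U - U'' Δ_α⁻¹)` with domain `H²(𝕋²)`: the pairs
`(w, g)` with `w ∈ H²`, `g ∈ L²` and `g = ν Δ_α w - α ∂_x (U w - U'' ψ)`, `ψ = Δ_α⁻¹ w`, the
equality being that of Fourier coefficients. -/
def graph (U : L2T) (ν α : ℝ) : Submodule ℂ (L2T2 × L2T2) where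
  carrier := {q | MemH2T2 q.1 ∧ ∃ ψ : L2T2, IsStream α q.1 ψ ∧ ∀ m n : ℤ,
    coeff2 q.2 m n = ν * (lapSymbol α m n * coeff2 q.1 m n)
      - α * (Complex.I * m * coeff2 (transport U (deriv2 U) q.1 ψ) m n)}
  zero_mem' := by
    refine ⟨?_, 0, ⟨coeff2_coe_zero 0 0, fun m n _ => ?_⟩, fun m n => ?_⟩
    · simp only [MemH2T2, Prod.fst_zero, coeff2_coe_zero]
      simp
    · simp only [Prod.fst_zero, coeff2_coe_zero, mul_zero]
    · have h : coeff2 (transport U (deriv2 U) 0 0) m n = 0 := by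
        have := coeff2_congr (transport_smul U (deriv2 U) 0 0 0) m n
        rw [coeff2_smul] at this
        simpa using this
      simp only [Prod.fst_zero, Prod.snd_zero, coeff2_coe_zero, h, mul_zero, sub_zero]
  add_mem' := by
    rintro ⟨w, g⟩ ⟨w', g'⟩ ⟨hw, ψ, ⟨h0, hψ⟩, hg⟩ ⟨hw', ψ', ⟨h0', hψ'⟩, hg'⟩
    refine ⟨hw.add hw', ψ + ψ', ⟨?_, fun m n hmn => ?_⟩, fun m n => ?_⟩
    · rw [coeff2_coe_add, h0, h0', add_zero]
    · simp only [Prod.mk_add_mk, coeff2_coe_add, mul_add, hψ m n hmn, hψ' m n hmn]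
    · have h := hg m n
      have h' := hg' m n
      simp only at h h'
      simp only [Prod.mk_add_mk]
      rw [coeff2_coe_add, coeff2_coe_add, coeff2_congr (transport_add _ _ _ _ _ _),
        coeff2_add (integrable_transport _ _ _ _) (integrable_transport _ _ _ _), h, h']
      ring
  smul_mem' := by
    rintro c ⟨w, g⟩ ⟨hw, ψ, ⟨h0, hψ⟩, hg⟩
    refine ⟨hw.smul c, c • ψ, ⟨?_, fun m n hmn => ?_⟩, fun m n => ?_⟩
    · rw [coeff2_coe_smul, h0, mul_zero]
    · have h := hψ m n hmn
      simp only at h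
      simp only [Prod.smul_mk, coeff2_coe_smul]
      rw [← h]
      ring
    · have h := hg m n
      simp only at h
      simp only [Prod.smul_mk]
      rw [coeff2_coe_smul, coeff2_coe_smul, coeff2_congr (transport_smul _ _ _ _ _),
        coeff2_smul, h]
      ring

/-- The Orr–Sommerfeld operator `𝓛_{ν,α}` as an unbounded operator on `L²(𝕋²)`; see
`graph_orrSommerfeld` below. -/
def orrSommerfeld (U : L2T) (ν α : ℝ) : L2T2 →ₗ.[ℂ] L2T2 := (graph U ν α).toLinearPMap

/-! The Fourier coefficients determine an element of `L²(𝕋²)`, hence `graph` is the graph of an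
operator. -/

theorem ae_eq_zero_of_fourierCoeff {f : Torus → ℂ} (hf : MemLp f 2 tmeas)
    (h : ∀ n, fourierCoeff f n = 0) : f =ᵐ[tmeas] 0 := by
  have h0 : hf.toLp f = 0 := by
    apply (fourierBasis (T := 2 * Real.pi)).repr.injective
    ext n
    rw [fourierBasis_repr, fourierCoeff_congr_ae hf.coeFn_toLp, h]
    simp
  exact hf.coeFn_toLp.symm.trans (h0 ▸ Lp.coeFn_zero ℂ 2 tmeas)

theorem norm_fourierCoeff_sq_le {f : Torus → ℂ} (hf : MemLp f 2 tmeas) (n : ℤ) :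
    ‖fourierCoeff f n‖ ^ 2 ≤ ∫ y, ‖f y‖ ^ 2 ∂tmeas := by
  have h := hasSum_sq_fourierCoeff (hf.toLp f)
  rw [fourierCoeff_congr_ae hf.coeFn_toLp] at h
  have h2 : ∫ y, ‖(hf.toLp f) y‖ ^ 2 ∂tmeas = ∫ y, ‖f y‖ ^ 2 ∂tmeas :=
    integral_congr_ae (by filter_upwards [hf.coeFn_toLp] with y hy; rw [hy])
  rw [← h2]
  exact le_hasSum h n fun _ _ => by positivity

theorem eq_zero_of_coeff2 (w : L2T2) (h : ∀ m n, coeff2 w m n = 0) : w = 0 := by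
  have hsq : Integrable (fun p => ‖w p‖ ^ 2) tmeas2 :=
    (memLp_two_iff_integrable_sq_norm (Lp.memLp w).1).1 (Lp.memLp w)
  have hsec : ∀ᵐ x ∂tmeas, MemLp (fun y => w (x, y)) 2 tmeas := by
    filter_upwards [(Lp.memLp w).1.prodMk_left, hsq.prod_right_ae] with x h1 h2
    exact (memLp_two_iff_integrable_sq_norm h1).2 h2
  have hcoeff : ∀ n, (fun x => fourierCoeff (fun y => w (x, y)) n) =ᵐ[tmeas] 0 := by
    intro n
    have hint : Integrable (fun p : Torus × Torus => fourier (-n) p.2 • w p) tmeas2 := by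
      simpa using integrable_fourier_mul (L2T2.integrable w) 0 n
    have hmeas : AEStronglyMeasurable (fun x => fourierCoeff (fun y => w (x, y)) n) tmeas :=
      hint.1.integral_prod_right'
    refine ae_eq_zero_of_fourierCoeff ((memLp_two_iff_integrable_sq_norm hmeas).2 ?_) fun m => ?_
    · refine hsq.integral_prod_left.mono' (hmeas.norm.pow 2) ?_
      filter_upwards [hsec] with x hx
      rw [Real.norm_of_nonneg (by positivity)]
      exact norm_fourierCoeff_sq_le hx n
    · rw [← h m n, coeff2, integral_prod _ (integrable_fourier_mul (L2T2.integrable w) m n)]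
      simp only [fourierCoeff, smul_eq_mul, mul_assoc, integral_const_mul]
  have hae : ∀ᵐ x ∂tmeas, ∀ᵐ y ∂tmeas, w (x, y) = 0 := by
    filter_upwards [hsec, ae_all_iff.2 hcoeff] with x hx hx'
    exact ae_eq_zero_of_fourierCoeff hx hx'
  have hz : ∫ p, ‖w p‖ ^ 2 ∂tmeas2 = 0 := by
    rw [integral_prod _ hsq]
    refine integral_eq_zero_of_ae ?_
    filter_upwards [hae] with x hx
    refine integral_eq_zero_of_ae ?_
    filter_upwards [hx] with y hy
    simp [hy]
  rw [integral_eq_zero_iff_of_nonneg (fun _ => by positivity) hsq] at hz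
  refine Lp.ext ?_
  filter_upwards [hz, Lp.coeFn_zero ℂ 2 tmeas2] with p hp hp'
  rw [hp']
  simpa using hp

theorem graph_orrSommerfeld (U : L2T) (ν : ℝ) {α : ℝ} (hα : α ≠ 0) :
    (orrSommerfeld U ν α).graph = graph U ν α := by
  refine Submodule.toLinearPMap_graph_eq _ ?_
  rintro ⟨w, g⟩ ⟨-, ψ, ⟨h0, hψ⟩, hg⟩ hw
  simp only at hw
  subst hw
  have hψ0 : ψ = 0 := by
    refine eq_zero_of_coeff2 ψ fun m n => ?_
    by_cases hmn : (m, n) = (0, 0)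
    · simp only [Prod.mk.injEq] at hmn
      rw [hmn.1, hmn.2, h0]
    · have h := hψ m n hmn
      simp only [coeff2_coe_zero, mul_eq_zero] at h
      refine h.resolve_left ?_
      unfold lapSymbol
      rw [neg_eq_zero, Complex.ofReal_eq_zero]
      intro h'
      have hm : (α * m) ^ 2 = 0 := by nlinarith [sq_nonneg (α * m), sq_nonneg (n : ℝ)]
      have hn : (n : ℝ) ^ 2 = 0 := by nlinarith [sq_nonneg (α * m), sq_nonneg (n : ℝ)]
      refine hmn (Prod.ext ?_ ?_)
      · simpa [hα] using hm
      · simpa using hn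
  subst hψ0
  refine eq_zero_of_coeff2 g fun m n => ?_
  have h : coeff2 (transport U (deriv2 U) 0 0) m n = 0 := by
    have := coeff2_congr (transport_smul U (deriv2 U) 0 0 0) m n
    rw [coeff2_smul] at this
    simpa using this
  have h' := hg m n
  simp only [coeff2_coe_zero, h, mul_zero, sub_zero] at h'
  exact h'

/-! ### The class `{e^{ikx} f(y) : f ∈ L²(𝕋)}` -/

theorem memLp_mode (k : ℤ) (f : L2T) :
    MemLp (fun p : Torus × Torus => fourier k p.1 * f p.2) 2 tmeas2 := by
  have h := (Lp.memLp f).comp_snd (μ := tmeas)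
  refine h.of_le ?_ (Filter.Eventually.of_forall fun p => ?_)
  · exact AEStronglyMeasurable.mul (Continuous.aestronglyMeasurable (by fun_prop)) h.1
  · simp only [fourier_apply, norm_mul, Circle.norm_coe, one_mul, le_refl]

/-- The map `f ↦ e^{ikx} f(y)`. -/
def mode (k : ℤ) : L2T →ₗ[ℂ] L2T2 where
  toFun f := (memLp_mode k f).toLp _
  map_add' f g := by
    rw [← MemLp.toLp_add, MemLp.toLp_eq_toLp_iff]
    have h := (Measure.quasiMeasurePreserving_snd (μ := tmeas) (ν := tmeas)).ae_eq_comp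
      (Lp.coeFn_add f g)
    filter_upwards [h] with p hp
    simp only [Function.comp, Pi.add_apply] at hp
    simp only [Pi.add_apply, hp, mul_add]
  map_smul' c f := by
    rw [RingHom.id_apply, ← MemLp.toLp_const_smul, MemLp.toLp_eq_toLp_iff]
    have h := (Measure.quasiMeasurePreserving_snd (μ := tmeas) (ν := tmeas)).ae_eq_comp
      (Lp.coeFn_smul c f)
    filter_upwards [h] with p hp
    simp only [Function.comp, Pi.smul_apply, smul_eq_mul] at hp
    simp only [Pi.smul_apply, smul_eq_mul, hp]
    ring

/-- The class `{e^{ikx} f(y) : f ∈ L²(𝕋)}`. -/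
def modeClass (k : ℤ) : Submodule ℂ L2T2 := LinearMap.range (mode k)

/-! ### Spectral notions for unbounded operators -/

section Spectral

variable {E : Type*} [NormedAddCommGroup E] [NormedSpace ℂ E]

/-- The part of an unbounded operator `A` in a subspace `K`: its domain is
`{f ∈ K : f ∈ D(A), A f ∈ K}`, where it acts as `A`. -/
def part (A : E →ₗ.[ℂ] E) (K : Submodule ℂ E) : K →ₗ.[ℂ] K where
  domain :=
    { carrier := {f | ∃ h : (f : E) ∈ A.domain, A ⟨f, h⟩ ∈ K}
      zero_mem' := ⟨A.domain.zero_mem, by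
        have h : A ⟨((0 : K) : E), A.domain.zero_mem⟩ = 0 := A.map_zero
        rw [h]
        exact K.zero_mem⟩
      add_mem' := by
        rintro f g ⟨hf, hf'⟩ ⟨hg, hg'⟩
        refine ⟨A.domain.add_mem hf hg, ?_⟩
        have h : A ⟨((f + g : K) : E), A.domain.add_mem hf hg⟩ = A ⟨f, hf⟩ + A ⟨g, hg⟩ :=
          A.map_add ⟨f, hf⟩ ⟨g, hg⟩
        rw [h]
        exact K.add_mem hf' hg'
      smul_mem' := by
        rintro c f ⟨hf, hf'⟩
        refine ⟨A.domain.smul_mem c hf, ?_⟩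
        have h : A ⟨((c • f : K) : E), A.domain.smul_mem c hf⟩ = c • A ⟨f, hf⟩ :=
          A.map_smul c ⟨f, hf⟩
        rw [h]
        exact K.smul_mem c hf' }
  toFun :=
    { toFun := fun f => ⟨A ⟨(f : K), f.2.choose⟩, f.2.choose_spec⟩
      map_add' := fun f g => Subtype.ext (A.map_add ⟨(f : K), f.2.choose⟩ ⟨(g : K), g.2.choose⟩)
      map_smul' := fun c f => Subtype.ext (A.map_smul c ⟨(f : K), f.2.choose⟩) }

theorem part_apply (A : E →ₗ.[ℂ] E) (K : Submodule ℂ E) (f : (part A K).domain) :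
    (part A K f : E) = A ⟨((f : K) : E), f.2.choose⟩ := rfl

/-- `z` is in the resolvent set of `A`: `A - z : D(A) → E` is a bijection with bounded inverse. -/
def InResolventSet (A : E →ₗ.[ℂ] E) (z : ℂ) : Prop :=
  ∃ R : E →L[ℂ] E, (∀ g : E, ∃ f : A.domain, (f : E) = R g ∧ A f - z • (f : E) = g) ∧
    ∀ f : A.domain, R (A f - z • (f : E)) = f

/-- The spectrum of an unbounded operator. -/
def spec (A : E →ₗ.[ℂ] E) : Set ℂ := {z | ¬ InResolventSet A z}

/-- `f` is an eigenvector of `A` with eigenvalue `z`. -/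
def IsEigenvector (A : E →ₗ.[ℂ] E) (z : ℂ) (f : E) : Prop :=
  f ≠ 0 ∧ ∃ h : f ∈ A.domain, A ⟨f, h⟩ = z • f

/-- `z` is an eigenvalue of `A`. -/
def IsEigenvalue (A : E →ₗ.[ℂ] E) (z : ℂ) : Prop := ∃ f, IsEigenvector A z f

/-- `z` is an algebraically simple eigenvalue of `A`: the eigenvectors are the nonzero multiples
of a single one, and there is no Jordan chain of length two, i.e. no solution of
`(A - z) h = f` with `f` an eigenvector. -/
def IsSimpleEigenvalue (A : E →ₗ.[ℂ] E) (z : ℂ) : Prop :=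
  (∃ f, IsEigenvector A z f ∧ ∀ g, IsEigenvector A z g → ∃ c : ℂ, g = c • f) ∧
    ∀ (h : A.domain) (f : E), IsEigenvector A z f → A h - z • (h : E) ≠ f

end Spectral

/-- The operator `𝓛_{ν,α}` in the class `{e^{ikx} f(y)}`. -/
def orrSommerfeldMode (U : L2T) (ν α : ℝ) (k : ℤ) : modeClass k →ₗ.[ℂ] modeClass k :=
  part (orrSommerfeld U ν α) (modeClass k)

/-- `e^{ikx} f(y)` as an element of the class. -/
def modeElem (k : ℤ) (f : L2T) : modeClass k := ⟨mode k f, LinearMap.mem_range_self _ f⟩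

end OrrSommerfeld

end

/-!
On the mode `e^{ikx}`, put `β = α k` and `ε = β / ν`. Conjugating by the vorticity map
`f ↦ f'' - β² f` and dividing by `ν` turns the operator into `∂_yy - β² - i ε K` on `L²(𝕋)`, with
`K` bounded in terms of `‖U‖_{H³}` only. For `ε = 0` this is diagonal in the Fourier basis and the
eigenvalue `-β²` of the constants is simple, at distance `1` from the rest of the spectrum, so for
small `ε` a contraction argument continues it to a simple eigenvalue, to the right of which there
is no other spectrum; the rest of the spectrum consists of eigenvalues since the resolvent is
compact.

The mean of `K 1` vanishes at leading order, so the eigenvalue moves only at second order. The first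
correction to the eigenvector `1` is proportional to `ε U`, which becomes the leading part after
rescaling, and the coefficient `ε² ‖∂_y⁻¹ U‖²` of the eigenvalue is read off the mean of `K U`.
-/

noncomputable section

namespace OrrSommerfeld

/-! ### Unbounded operators: resolvents, perturbation and similarity -/

section Unbounded

variable {E : Type*} [NormedAddCommGroup E] [NormedSpace ℂ E] {A : E →ₗ.[ℂ] E} {z : ℂ}

theorem isEigenvector_iff_mem_graph {f : E} :
    IsEigenvector A z f ↔ f ≠ 0 ∧ (f, z • f) ∈ A.graph := by
  rw [LinearPMap.mem_graph_iff, IsEigenvector]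
  refine and_congr_right fun _ => ⟨fun ⟨hf, h⟩ => ⟨⟨f, hf⟩, rfl, h⟩, ?_⟩
  rintro ⟨⟨_, hf⟩, rfl, h⟩
  exact ⟨hf, h⟩

theorem isEigenvector_smul {f : E} {c : ℂ} (hc : c ≠ 0) (hf : IsEigenvector A z f) :
    IsEigenvector A z (c • f) := by
  rw [isEigenvector_iff_mem_graph] at hf ⊢
  refine ⟨smul_ne_zero hc hf.1, ?_⟩
  rw [smul_comm]
  exact A.graph.smul_mem c hf.2

theorem isSimpleEigenvalue_iff_graph :
    IsSimpleEigenvalue A z ↔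
      (∃ f, IsEigenvector A z f ∧ ∀ g, IsEigenvector A z g → ∃ c : ℂ, g = c • f) ∧
        ∀ h f, IsEigenvector A z f → (h, f + z • h) ∉ A.graph := by
  refine and_congr_right fun _ => ⟨fun H h f hf hmem => ?_, fun H h f hf hh => ?_⟩
  · obtain ⟨y, rfl, hy⟩ := (LinearPMap.mem_graph_iff A).1 hmem
    exact H y f hf (sub_eq_of_eq_add hy)
  · refine H h f hf ?_
    rw [← hh, sub_add_cancel]
    exact A.mem_graph h

theorem mem_graph_vadd {B : E →ₗ[ℂ] E} {h r : E} :
    (h, r) ∈ (B +ᵥ A).graph ↔ (h, r - B h) ∈ A.graph := by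
  rw [LinearPMap.mem_graph_iff, LinearPMap.mem_graph_iff]
  refine exists_congr fun y => and_congr_right ?_
  rintro rfl
  exact eq_sub_iff_add_eq'.symm

theorem mem_graph_part {K : Submodule ℂ E} {x y : K} :
    (x, y) ∈ (part A K).graph ↔ ((x : E), (y : E)) ∈ A.graph := by
  rw [LinearPMap.mem_graph_iff, LinearPMap.mem_graph_iff]
  constructor
  · rintro ⟨f, rfl, rfl⟩
    exact ⟨⟨_, f.2.choose⟩, rfl, (part_apply A K f).symm⟩
  · rintro ⟨⟨_, hf⟩, rfl, hy⟩
    exact ⟨⟨x, hf, hy ▸ y.2⟩, rfl, Subtype.ext hy⟩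

/-- `R` is the resolvent `(A - z)⁻¹`: the pair `(h, r)` lies in the graph of `A` if and only if
`h = R (r - z h)`. -/
structure IsResolvent (A : E →ₗ.[ℂ] E) (z : ℂ) (R : E →L[ℂ] E) : Prop where
  mem_graph : ∀ g, (R g, g + z • R g) ∈ A.graph
  apply_sub : ∀ h r, (h, r) ∈ A.graph → R (r - z • h) = h

theorem inResolventSet_iff_exists_isResolvent :
    InResolventSet A z ↔ ∃ R, IsResolvent A z R := by
  refine exists_congr fun R => ⟨fun ⟨h₁, h₂⟩ => ⟨fun g => ?_, fun h r hr => ?_⟩,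
    fun hR => ⟨fun g => ?_, fun f => hR.apply_sub _ _ (A.mem_graph f)⟩⟩
  · obtain ⟨f, hf, hg⟩ := h₁ g
    rw [← hf, ← sub_eq_iff_eq_add.1 hg]
    exact A.mem_graph f
  · obtain ⟨f, rfl, rfl⟩ := (LinearPMap.mem_graph_iff A).1 hr
    exact h₂ f
  · obtain ⟨f, hf, hg⟩ := (LinearPMap.mem_graph_iff A).1 (hR.mem_graph g)
    exact ⟨f, hf, by rw [hg, hf]; exact add_sub_cancel_right _ _⟩

/-- Factorisation `A + B - z = (1 + (B - (z - z₀)) R) (A - z₀)` on the domain of `A`. -/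
theorem IsResolvent.vadd {z₀ : ℂ} {R B : E →L[ℂ] E} (hR : IsResolvent A z₀ R) (u : E ≃L[ℂ] E)
    (hu : ∀ q, u q = q + (B (R q) - (z - z₀) • R q)) :
    IsResolvent ((B : E →ₗ[ℂ] E) +ᵥ A) z (R ∘L (u.symm : E →L[ℂ] E)) := by
  refine ⟨fun g => ?_, fun h r hr => ?_⟩
  · obtain ⟨q, rfl⟩ := u.surjective g
    rw [mem_graph_vadd]
    convert hR.mem_graph q using 2
    · exact congrArg R (u.symm_apply_apply q)
    · change u q + z • R (u.symm (u q)) - B (R (u.symm (u q))) = _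
      rw [u.symm_apply_apply, hu]
      module
  · rw [mem_graph_vadd, ContinuousLinearMap.coe_coe] at hr
    have hh : R (r - B h - z₀ • h) = h := hR.apply_sub _ _ hr
    have huq : r - z • h = u (r - B h - z₀ • h) := by
      rw [hu, hh]
      module
    rw [huq, ContinuousLinearMap.comp_apply, ContinuousLinearEquiv.coe_coe, u.symm_apply_apply, hh]

theorem exists_compact_isResolvent_vadd [CompleteSpace E] {R B : E →L[ℂ] E}
    (hR : IsResolvent A z R) (hc : IsCompactOperator R) (hB : ‖B‖ * ‖R‖ < 1) :
    ∃ R' : E →L[ℂ] E, IsResolvent ((B : E →ₗ[ℂ] E) +ᵥ A) z R' ∧ IsCompactOperator R' := by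
  obtain ⟨u, hu⟩ : IsUnit (1 - -(B * R)) :=
    isUnit_one_sub_of_norm_lt_one (by rw [norm_neg]; exact (norm_mul_le B R).trans_lt hB)
  refine ⟨_, hR.vadd (ContinuousLinearEquiv.ofUnit u) fun q => ?_, hc.comp_clm _⟩
  change (u : E →L[ℂ] E) q = q + ((B * R) q - _)
  rw [hu, sub_neg_eq_add, sub_self, zero_smul, sub_zero]
  rfl

theorem isEigenvalue_of_mem_spec [CompleteSpace E] {z₀ : ℂ} {R : E →L[ℂ] E}
    (hR : IsResolvent A z₀ R) (hc : IsCompactOperator R) (hz : z ∈ spec A) :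
    IsEigenvalue A z := by
  have hne : z - z₀ ≠ 0 := by
    rintro h
    rw [sub_eq_zero.1 h] at hz
    exact hz (inResolventSet_iff_exists_isResolvent.2 ⟨R, hR⟩)
  rcases hc.hasEigenvalue_or_mem_resolventSet (inv_ne_zero hne) with h | h
  · obtain ⟨v, hv⟩ := h.exists_hasEigenvector
    have hRv : R ((z - z₀) • v) = v := by
      rw [map_smul, show R v = (z - z₀)⁻¹ • v from hv.apply_eq_smul, smul_inv_smul₀ hne]
    refine ⟨v, isEigenvector_iff_mem_graph.2 ⟨hv.2, ?_⟩⟩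
    convert hR.mem_graph ((z - z₀) • v) using 2
    · exact hRv.symm
    · rw [hRv]; module
  · refine absurd (inResolventSet_iff_exists_isResolvent.2 ?_) hz
    obtain ⟨u, hu⟩ : IsUnit (1 - (z - z₀) • R) := by
      rw [spectrum.mem_resolventSet_iff, Algebra.algebraMap_eq_smul_one] at h
      simpa [Units.smul_def] using
        (IsUnit.smul_sub_iff_sub_inv_smul (r := (Units.mk0 _ hne)⁻¹) (a := R)).1 h
    have hR' := hR.vadd (B := 0) (z := z) (ContinuousLinearEquiv.ofUnit u) fun q => by
      change (u : E →L[ℂ] E) q = q + (0 - (z - z₀) • R q)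
      rw [hu, zero_sub, ← sub_eq_add_neg]
      rfl
    rw [ContinuousLinearMap.toLinearMap_zero, zero_vadd] at hR'
    exact ⟨_, hR'⟩

/-- `A` acts as `c B` under the identification `J`. -/
def IsSimilarBy {F : Type*} [NormedAddCommGroup F] [NormedSpace ℂ F] (A : E →ₗ.[ℂ] E)
    (B : F →ₗ.[ℂ] F) (J : F ≃L[ℂ] E) (c : ℂ) : Prop :=
  ∀ h r, (J h, c • J r) ∈ A.graph ↔ (h, r) ∈ B.graph

namespace IsSimilarBy

variable {F : Type*} [NormedAddCommGroup F] [NormedSpace ℂ F] {B : F →ₗ.[ℂ] F}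
  {J : F ≃L[ℂ] E} {c : ℂ} (hAB : IsSimilarBy A B J c)
include hAB

theorem isEigenvector_iff {h : F} : IsEigenvector A (c * z) (J h) ↔ IsEigenvector B z h := by
  rw [isEigenvector_iff_mem_graph, isEigenvector_iff_mem_graph, ← hAB, map_smul, smul_smul, Ne,
    map_eq_zero_iff J J.injective]

theorem isEigenvalue_iff : IsEigenvalue A (c * z) ↔ IsEigenvalue B z :=
  J.surjective.exists.trans <| exists_congr fun _ => hAB.isEigenvector_iff

theorem inResolventSet (hc : c ≠ 0) (hz : InResolventSet B z) : InResolventSet A (c * z) := by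
  rw [inResolventSet_iff_exists_isResolvent] at hz ⊢
  obtain ⟨R, hR⟩ := hz
  refine ⟨(J : F →L[ℂ] E) ∘L R ∘L (c⁻¹ • (J.symm : E →L[ℂ] F)), fun g => ?_, fun h r hr => ?_⟩
  · have hmem := (hAB _ _).2 (hR.mem_graph (c⁻¹ • J.symm g))
    rw [J.map_add, J.map_smul, J.map_smul, J.apply_symm_apply, smul_add, smul_inv_smul₀ hc,
      smul_smul] at hmem
    exact hmem
  · have hmem : (J.symm h, c⁻¹ • J.symm r) ∈ B.graph := by
      rw [← hAB, map_smul, smul_inv_smul₀ hc, J.apply_symm_apply, J.apply_symm_apply]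
      exact hr
    have harg : c⁻¹ • J.symm (r - (c * z) • h) = c⁻¹ • J.symm r - z • J.symm h := by
      rw [map_sub, map_smul, smul_sub, smul_smul, inv_mul_cancel_left₀ hc]
    change J (R (c⁻¹ • J.symm (r - (c * z) • h))) = h
    rw [harg, hR.apply_sub _ _ hmem, J.apply_symm_apply]

theorem isSimpleEigenvalue (hc : c ≠ 0) (hz : IsSimpleEigenvalue B z) :
    IsSimpleEigenvalue A (c * z) := by
  rw [isSimpleEigenvalue_iff_graph] at hz ⊢
  obtain ⟨⟨f, hf, huniq⟩, hjordan⟩ := hz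
  refine ⟨⟨J f, hAB.isEigenvector_iff.2 hf, J.surjective.forall.2 fun g hg => ?_⟩,
    J.surjective.forall.2 fun h => J.surjective.forall.2 fun g hg hmem => ?_⟩
  · obtain ⟨a, rfl⟩ := huniq g (hAB.isEigenvector_iff.1 hg)
    exact ⟨a, map_smul J a f⟩
  · have hg' := hAB.isEigenvector_iff.1 hg
    refine hjordan h (c⁻¹ • g) ?_ ((hAB _ _).1 ?_)
    · rw [isEigenvector_iff_mem_graph] at hg' ⊢
      refine ⟨smul_ne_zero (inv_ne_zero hc) hg'.1, ?_⟩
      rw [smul_comm]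
      exact B.graph.smul_mem c⁻¹ hg'.2
    · rw [map_add, map_smul, map_smul, smul_add, smul_inv_smul₀ hc, smul_smul]
      exact hmem

end IsSimilarBy
end Unbounded

/-! ### Perturbation of a simple eigenvalue -/

section Perturbation

variable {E : Type*} [NormedAddCommGroup E] [NormedSpace ℂ E]

/-- A simple eigenvalue `a` of `A`, with eigenvector `e` and spectral projection `f ↦ φ f • e`,
together with the reduced resolvent `R z`, the inverse of `A - z` on `ker φ` extended by
`R z e = 0`. It exists, with norm at most `ρ`, for all `z ∈ s`; so `a` is the only point of the
spectrum in `s`. -/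
structure IsSpectralSplitting (A : E →ₗ.[ℂ] E) (a : ℂ) (e : E) (φ : E →L[ℂ] ℂ) (s : Set ℂ)
    (R : ℂ → E →L[ℂ] E) (ρ : ℝ) : Prop where
  mem_graph : (e, a • e) ∈ A.graph
  map_graph : ∀ {h r}, (h, r) ∈ A.graph → φ r = a * φ h
  map_self : φ e = 1
  norm_le_one : ‖e‖ ≤ 1
  norm_functional_le_one : ‖φ‖ ≤ 1
  resolvent_mem : ∀ {z}, z ∈ s → ∀ f, (R z f, f - φ f • e + z • R z f) ∈ A.graph
  resolvent_sub : ∀ {z}, z ∈ s → ∀ {h r}, (h, r) ∈ A.graph → R z (r - z • h) = h - φ h • e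
  map_resolvent : ∀ {z}, z ∈ s → ∀ f, φ (R z f) = 0
  norm_resolvent_le : ∀ {z}, z ∈ s → ‖R z‖ ≤ ρ

variable {A : E →ₗ.[ℂ] E} {a : ℂ} {e : E} {φ : E →L[ℂ] ℂ} {s : Set ℂ} {R : ℂ → E →L[ℂ] E}
  {ρ : ℝ} {z z' : ℂ} {B : E →L[ℂ] E}

/-- First-order perturbation formula for the eigenvalue with eigenvector `e + g`, `φ g = 0`. -/
def perturbedEigenvalue (a : ℂ) (e : E) (φ : E →L[ℂ] ℂ) (B : E →L[ℂ] E) (g : E) : ℂ :=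
  a + φ (B (e + g))

/-- The map whose fixed points are the corrections `g` for which `e + g` is an eigenvector of the
perturbed operator. -/
def correctionMap (a : ℂ) (e : E) (φ : E →L[ℂ] ℂ) (R : ℂ → E →L[ℂ] E) (B : E →L[ℂ] E) (g : E) : E :=
  -R (perturbedEigenvalue a e φ B g) (B (e + g))

namespace IsSpectralSplitting

variable (hA : IsSpectralSplitting A a e φ s R ρ)
include hA

theorem norm_apply_le (f : E) : ‖φ f‖ ≤ ‖f‖ := by
  simpa using φ.le_of_opNorm_le hA.norm_functional_le_one f

theorem norm_resolvent_apply_le (hz : z ∈ s) (f : E) : ‖R z f‖ ≤ ρ * ‖f‖ :=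
  (R z).le_of_opNorm_le (hA.norm_resolvent_le hz) f

theorem resolvent_self (hz : z ∈ s) : R z e = 0 := by
  have h := hA.resolvent_sub hz (hA.resolvent_mem hz e)
  rw [hA.map_resolvent hz, hA.map_self, one_smul, sub_self, zero_add, sub_self, map_zero,
    zero_smul, sub_zero] at h
  exact h.symm

theorem resolvent_sub_resolvent (hz : z ∈ s) (hz' : z' ∈ s) (f : E) :
    R z f - R z' f = (z - z') • R z' (R z f) := by
  have h := hA.resolvent_sub hz' (hA.resolvent_mem hz f)
  rw [hA.map_resolvent hz, zero_smul, sub_zero, add_sub_assoc, ← sub_smul, map_add, map_sub,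
    map_smul, hA.resolvent_self hz', smul_zero, sub_zero, map_smul] at h
  exact sub_eq_of_eq_add' h.symm

theorem mem_graph_vadd_iff (hz : z ∈ s) {h r : E} :
    (h, r + z • h) ∈ ((B : E →ₗ[ℂ] E) +ᵥ A).graph ↔
      h = φ h • e + R z (r - B h) ∧ (a - z) * φ h = φ (r - B h) := by
  have hsub : r + z • h - B h - z • h = r - B h := by abel
  rw [mem_graph_vadd, ContinuousLinearMap.coe_coe]
  refine ⟨fun hmem => ⟨?_, ?_⟩, fun ⟨hh, hφ⟩ => ?_⟩
  · rw [← hsub, hA.resolvent_sub hz hmem, add_sub_cancel]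
  · rw [sub_mul, ← hA.map_graph hmem, ← smul_eq_mul z, ← map_smul, ← map_sub, hsub]
  · have hmem := A.graph.add_mem (A.graph.smul_mem (φ h) hA.mem_graph)
      (hA.resolvent_mem hz (r - B h))
    have hRz : R z (r - B h) = h - φ h • e := eq_sub_of_add_eq' hh.symm
    rw [Prod.smul_mk, Prod.mk_add_mk, ← hh, ← hφ, hRz] at hmem
    convert hmem using 2
    module

theorem norm_resolvent_sub_resolvent_le (hz : z ∈ s) (hz' : z' ∈ s) (f : E) :
    ‖R z f - R z' f‖ ≤ ‖z - z'‖ * (ρ * (ρ * ‖f‖)) := by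
  have hρ : 0 ≤ ρ := (norm_nonneg _).trans (hA.norm_resolvent_le hz)
  rw [hA.resolvent_sub_resolvent hz hz', norm_smul]
  gcongr
  exact (hA.norm_resolvent_apply_le hz' _).trans (by gcongr; exact hA.norm_resolvent_apply_le hz f)

theorem norm_self_add_le {g : E} (hg : ‖g‖ ≤ 1 / 3) : ‖e + g‖ ≤ 4 / 3 := by
  linarith [norm_add_le e g, hA.norm_le_one]

theorem perturbedEigenvalue_mem {g : E} (hg : ‖g‖ ≤ 1 / 3) :
    perturbedEigenvalue a e φ B g ∈ Metric.closedBall a (4 / 3 * ‖B‖) := by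
  rw [perturbedEigenvalue, mem_closedBall_iff_norm, add_sub_cancel_left]
  calc _ ≤ ‖B (e + g)‖ := hA.norm_apply_le _
    _ ≤ ‖B‖ * (4 / 3) := B.le_opNorm_of_le (hA.norm_self_add_le hg)
    _ = _ := mul_comm _ _

section

variable (hB : ρ * ‖B‖ ≤ 1 / 4)
include hB

theorem norm_resolvent_comp_le (hz : z ∈ s) (f : E) : ‖R z (B f)‖ ≤ 1 / 4 * ‖f‖ := by
  have hρ : 0 ≤ ρ := (norm_nonneg _).trans (hA.norm_resolvent_le hz)
  calc ‖R z (B f)‖ ≤ ρ * (‖B‖ * ‖f‖) :=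
        (hA.norm_resolvent_apply_le hz _).trans (by gcongr; exact B.le_opNorm f)
    _ = ρ * ‖B‖ * ‖f‖ := by ring
    _ ≤ 1 / 4 * ‖f‖ := by gcongr

theorem eq_smul_add_of_isEigenvector (hz : z ∈ s) {h : E}
    (hh : IsEigenvector ((B : E →ₗ[ℂ] E) +ᵥ A) z h) :
    ∃ g, (‖g‖ ≤ 1 / 3 ∧ correctionMap a e φ R B g = g) ∧
      z = perturbedEigenvalue a e φ B g ∧ h = φ h • (e + g) := by
  obtain ⟨hne, hmem⟩ := isEigenvector_iff_mem_graph.1 hh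
  rw [← zero_add (z • h), hA.mem_graph_vadd_iff hz, zero_sub, map_neg, map_neg,
    ← sub_eq_add_neg] at hmem
  obtain ⟨hh, hφ⟩ := hmem
  have hφh : φ h ≠ 0 := by
    intro h0
    rw [h0, zero_smul, zero_sub] at hh
    have hle := hA.norm_resolvent_comp_le hB hz h
    rw [← norm_neg, ← hh] at hle
    exact hne (norm_le_zero_iff.1 (by linarith [norm_nonneg h]))
  set g := -R z (B ((φ h)⁻¹ • h)) with hg
  have heg : (φ h)⁻¹ • h = e + g := by
    rw [hg, map_smul, map_smul, ← sub_eq_add_neg]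
    simpa only [smul_sub, inv_smul_smul₀ hφh] using congrArg ((φ h)⁻¹ • ·) hh
  have hz' : z = perturbedEigenvalue a e φ B g := by
    rw [perturbedEigenvalue, ← heg, map_smul, map_smul, smul_eq_mul, ← neg_eq_iff_eq_neg.2 hφ]
    field_simp
    ring
  have hg_le : ‖g‖ ≤ 1 / 3 := by
    have hle := hA.norm_resolvent_comp_le hB hz (e + g)
    rw [← heg, ← norm_neg, ← hg, heg] at hle
    linarith [norm_add_le e g, hA.norm_le_one]
  refine ⟨g, ⟨hg_le, ?_⟩, hz', ?_⟩
  · rw [correctionMap, ← hz', ← heg, ← hg]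
  · rw [← heg, smul_inv_smul₀ hφh]

end

variable (hs : Metric.closedBall a (4 / 3 * ‖B‖) ⊆ s)
include hs

theorem apply_fixedPoint {g : E} (hg : ‖g‖ ≤ 1 / 3) (hfix : correctionMap a e φ R B g = g) :
    φ g = 0 := by
  rw [← hfix, correctionMap, map_neg, hA.map_resolvent (hs (hA.perturbedEigenvalue_mem hg)),
    neg_zero]

theorem isEigenvector_of_fixedPoint {g : E} (hg : ‖g‖ ≤ 1 / 3)
    (hfix : correctionMap a e φ R B g = g) :
    IsEigenvector ((B : E →ₗ[ℂ] E) +ᵥ A) (perturbedEigenvalue a e φ B g) (e + g) := by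
  have hz := hs (hA.perturbedEigenvalue_mem (B := B) hg)
  have hφ : φ (e + g) = 1 := by
    rw [map_add, hA.map_self, hA.apply_fixedPoint hs hg hfix, add_zero]
  refine isEigenvector_iff_mem_graph.2 ⟨fun h0 => by simp [h0] at hφ, ?_⟩
  rw [← zero_add (_ • (e + g)), hA.mem_graph_vadd_iff hz, hφ, one_smul, zero_sub, map_neg, map_neg]
  refine ⟨congrArg (e + ·) hfix.symm, ?_⟩
  rw [perturbedEigenvalue]
  ring

variable (hB : ρ * ‖B‖ ≤ 1 / 4)
include hB

theorem mapsTo_correctionMap :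
    Set.MapsTo (correctionMap a e φ R B) (Metric.closedBall 0 (1 / 3))
      (Metric.closedBall 0 (1 / 3)) := by
  intro g hg
  rw [mem_closedBall_zero_iff] at hg ⊢
  have hz := hs (hA.perturbedEigenvalue_mem hg)
  have hρ : 0 ≤ ρ := (norm_nonneg _).trans (hA.norm_resolvent_le hz)
  calc ‖correctionMap a e φ R B g‖ ≤ ρ * ‖B (e + g)‖ := by
        rw [correctionMap, norm_neg]
        exact hA.norm_resolvent_apply_le hz _
    _ ≤ ρ * (‖B‖ * (4 / 3)) := by gcongr; exact B.le_opNorm_of_le (hA.norm_self_add_le hg)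
    _ ≤ 1 / 3 := by linarith

theorem dist_correctionMap_le {g g' : E} (hg : ‖g‖ ≤ 1 / 3) (hg' : ‖g'‖ ≤ 1 / 3) :
    dist (correctionMap a e φ R B g) (correctionMap a e φ R B g') ≤ 1 / 3 * dist g g' := by
  set z := perturbedEigenvalue a e φ B g with hz_def
  set z' := perturbedEigenvalue a e φ B g' with hz'_def
  have hz : z ∈ s := hs (hA.perturbedEigenvalue_mem hg)
  have hz' : z' ∈ s := hs (hA.perturbedEigenvalue_mem hg')
  have hρ : 0 ≤ ρ := (norm_nonneg _).trans (hA.norm_resolvent_le hz)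
  have hzz' : ‖z - z'‖ ≤ ‖B‖ * ‖g - g'‖ := by
    rw [hz_def, hz'_def, perturbedEigenvalue, perturbedEigenvalue, add_sub_add_left_eq_sub,
      ← map_sub, ← map_sub, add_sub_add_left_eq_sub]
    exact (hA.norm_apply_le _).trans (B.le_opNorm _)
  have hdecomp : correctionMap a e φ R B g - correctionMap a e φ R B g' =
      -(R z (B (g - g')) + (R z (B (e + g')) - R z' (B (e + g')))) := by
    rw [correctionMap, correctionMap, ← hz_def, ← hz'_def, ← add_sub_add_left_eq_sub g g' e,
      map_sub, map_sub]
    abel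
  rw [dist_eq_norm, dist_eq_norm, hdecomp, norm_neg]
  calc _ ≤ ρ * ‖B (g - g')‖ + ‖z - z'‖ * (ρ * (ρ * ‖B (e + g')‖)) :=
        (norm_add_le _ _).trans (add_le_add (hA.norm_resolvent_apply_le hz _)
          (hA.norm_resolvent_sub_resolvent_le hz hz' _))
    _ ≤ ρ * (‖B‖ * ‖g - g'‖) + ‖B‖ * ‖g - g'‖ * (ρ * (ρ * (‖B‖ * (4 / 3)))) := by
        gcongr
        · exact B.le_opNorm _
        · exact B.le_opNorm_of_le (hA.norm_self_add_le hg')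
    _ = (ρ * ‖B‖ * (1 + 4 / 3 * (ρ * ‖B‖))) * ‖g - g'‖ := by ring
    _ ≤ (1 / 4 * (1 + 4 / 3 * (1 / 4))) * ‖g - g'‖ := by gcongr
    _ = 1 / 3 * ‖g - g'‖ := by ring

theorem existsUnique_fixedPoint [CompleteSpace E] :
    ∃! g, ‖g‖ ≤ 1 / 3 ∧ correctionMap a e φ R B g = g := by
  have hmaps := hA.mapsTo_correctionMap hs hB
  have hcontr : ContractingWith (1 / 3) (hmaps.restrict _ _ _) := by
    refine ⟨by rw [← NNReal.coe_lt_coe]; norm_num, LipschitzWith.of_dist_le_mul fun g g' => ?_⟩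
    have hle := hA.dist_correctionMap_le hs hB (mem_closedBall_zero_iff.1 g.2)
      (mem_closedBall_zero_iff.1 g'.2)
    simpa only [Subtype.dist_eq, Set.MapsTo.val_restrict_apply, NNReal.coe_div, NNReal.coe_one,
      NNReal.coe_ofNat] using hle
  obtain ⟨g, hg, hfix, -⟩ := hcontr.exists_fixedPoint' Metric.isClosed_closedBall.isComplete
    hmaps (x := 0) (by simp) (edist_ne_top _ _)
  rw [mem_closedBall_zero_iff] at hg
  refine ⟨g, ⟨hg, hfix⟩, fun g' ⟨hg', hfix'⟩ => dist_le_zero.1 ?_⟩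
  have hle := hA.dist_correctionMap_le hs hB hg' hg
  rw [hfix', hfix] at hle
  linarith [dist_nonneg (x := g') (y := g)]

/-- If `(A + B - z) h = c (e + g)` then `y = h - φ h (e + g)` solves the same equation and
`φ y = 0`, which bounds `y` by `c` and then `c` by `|c| / 9`. -/
theorem eq_zero_of_jordanChain {g : E} (hg : ‖g‖ ≤ 1 / 3)
    (hfix : correctionMap a e φ R B g = g) {h : E} {c : ℂ}
    (hh : (h, c • (e + g) + perturbedEigenvalue a e φ B g • h) ∈
      ((B : E →ₗ[ℂ] E) +ᵥ A).graph) : c = 0 := by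
  set z := perturbedEigenvalue a e φ B g
  have hz : z ∈ s := hs (hA.perturbedEigenvalue_mem hg)
  have hφ : φ (e + g) = 1 := by
    rw [map_add, hA.map_self, hA.apply_fixedPoint hs hg hfix, add_zero]
  have hv : (e + g, z • (e + g)) ∈ ((B : E →ₗ[ℂ] E) +ᵥ A).graph :=
    (isEigenvector_iff_mem_graph.1 (hA.isEigenvector_of_fixedPoint hs hg hfix)).2
  obtain ⟨y, hy⟩ : ∃ y, y = h - φ h • (e + g) := ⟨_, rfl⟩
  have hφy : φ y = 0 := by rw [hy, map_sub, map_smul, hφ, smul_eq_mul, mul_one, sub_self]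
  have hmem : (y, c • (e + g) + z • y) ∈ ((B : E →ₗ[ℂ] E) +ᵥ A).graph := by
    convert Submodule.sub_mem _ hh (Submodule.smul_mem _ (φ h) hv) using 1
    rw [Prod.smul_mk, Prod.mk_sub_mk, hy]
    congr 1
    module
  rw [hA.mem_graph_vadd_iff hz, hφy, zero_smul, zero_add, mul_zero, map_sub, map_sub, map_smul,
    map_smul, map_add, hA.resolvent_self hz, zero_add, hφ, smul_eq_mul, mul_one] at hmem
  obtain ⟨hyR, hc⟩ := hmem
  have hy_le : ‖y‖ ≤ 4 / 9 * (ρ * ‖c‖) := by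
    have hRg : ‖c • R z g‖ ≤ 1 / 3 * (ρ * ‖c‖) := by
      rw [norm_smul]
      calc ‖c‖ * ‖R z g‖ ≤ ‖c‖ * (ρ * (1 / 3)) := by
            gcongr
            exact (R z).le_of_opNorm_le_of_le (hA.norm_resolvent_le hz) hg
        _ = _ := by ring
    have hle := norm_sub_le (c • R z g) (R z (B y))
    rw [← hyR] at hle
    linarith [hA.norm_resolvent_comp_le hB hz y]
  have hc_le : ‖c‖ ≤ 1 / 9 * ‖c‖ :=
    calc ‖c‖ = ‖φ (B y)‖ := by rw [sub_eq_zero.1 hc.symm]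
      _ ≤ ‖B‖ * (4 / 9 * (ρ * ‖c‖)) := (hA.norm_apply_le _).trans (B.le_opNorm_of_le hy_le)
      _ = 4 / 9 * (ρ * ‖B‖) * ‖c‖ := by ring
      _ ≤ 4 / 9 * (1 / 4) * ‖c‖ := by gcongr
      _ = 1 / 9 * ‖c‖ := by ring
  exact norm_le_zero_iff.1 (by linarith [norm_nonneg c])

theorem exists_isSimpleEigenvalue [CompleteSpace E] :
    ∃ g, ‖g‖ ≤ 1 / 3 ∧ correctionMap a e φ R B g = g ∧
      IsEigenvector ((B : E →ₗ[ℂ] E) +ᵥ A) (perturbedEigenvalue a e φ B g) (e + g) ∧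
      IsSimpleEigenvalue ((B : E →ₗ[ℂ] E) +ᵥ A) (perturbedEigenvalue a e φ B g) ∧
      ∀ z ∈ s, IsEigenvalue ((B : E →ₗ[ℂ] E) +ᵥ A) z → z = perturbedEigenvalue a e φ B g := by
  obtain ⟨g, ⟨hg, hfix⟩, huniq⟩ := hA.existsUnique_fixedPoint hs hB
  have hv := hA.isEigenvector_of_fixedPoint hs hg hfix
  have hz := hs (hA.perturbedEigenvalue_mem (B := B) hg)
  have hmult {f : E} (hf : IsEigenvector ((B : E →ₗ[ℂ] E) +ᵥ A) (perturbedEigenvalue a e φ B g) f) :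
      f = φ f • (e + g) := by
    obtain ⟨g', hg', -, hfg'⟩ := hA.eq_smul_add_of_isEigenvector hB hz hf
    rwa [huniq g' hg'] at hfg'
  refine ⟨g, hg, hfix, hv, isSimpleEigenvalue_iff_graph.2
    ⟨⟨_, hv, fun f hf => ⟨_, hmult hf⟩⟩, fun h f hf hmem => hf.1 ?_⟩, ?_⟩
  · rw [hmult hf] at hmem ⊢
    rw [hA.eq_zero_of_jordanChain hs hB hg hfix hmem, zero_smul]
  · rintro z hz ⟨f, hf⟩
    obtain ⟨g', hg', hzg', -⟩ := hA.eq_smul_add_of_isEigenvector hB hz hf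
    rw [hzg', huniq g' hg']

end IsSpectralSplitting
end Perturbation

/-! ### Fourier coefficients and Fourier multipliers -/

/-- The Fourier coefficient of index `n` as a continuous linear functional on `L²(𝕋)`. -/
def coeffL (n : ℤ) : L2T →L[ℂ] ℂ := innerSL ℂ (fourierBasis (T := 2 * Real.pi) n)

theorem coeffL_apply (n : ℤ) (f : L2T) : coeffL n f = fourierCoeff f n := by
  rw [← fourierBasis_repr, HilbertBasis.repr_apply_apply]
  rfl

theorem fourierCoeff_coe_add (f g : L2T) (n : ℤ) :
    fourierCoeff (f + g : L2T) n = fourierCoeff f n + fourierCoeff g n := by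
  simp only [← coeffL_apply, map_add]

theorem fourierCoeff_coe_sub (f g : L2T) (n : ℤ) :
    fourierCoeff (f - g : L2T) n = fourierCoeff f n - fourierCoeff g n := by
  simp only [← coeffL_apply, map_sub]

theorem fourierCoeff_coe_smul (c : ℂ) (f : L2T) (n : ℤ) :
    fourierCoeff (c • f : L2T) n = c * fourierCoeff f n := by
  simp only [← coeffL_apply, map_smul, smul_eq_mul]

theorem fourierCoeff_ext {f g : L2T} (h : ∀ n, fourierCoeff f n = fourierCoeff g n) : f = g := by
  apply (fourierBasis (T := 2 * Real.pi)).repr.injective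
  ext n
  rw [fourierBasis_repr, fourierBasis_repr, h]

theorem fourierCoeff_fourierBasis (m n : ℤ) :
    fourierCoeff (fourierBasis (T := 2 * Real.pi) m : L2T) n = if n = m then 1 else 0 := by
  rw [← coeffL_apply, coeffL, innerSL_apply_apply]
  exact orthonormal_iff_ite.1 (fourierBasis (T := 2 * Real.pi)).orthonormal n m

theorem memℓp_fourierCoeff (f : L2T) : Memℓp (fun n => fourierCoeff f n) 2 := by
  have h := ((fourierBasis (T := 2 * Real.pi)).repr f).2
  exact (funext fun n => fourierBasis_repr f n : _ = fun n => fourierCoeff f n) ▸ h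

theorem hasSum_norm_sq (f : L2T) : HasSum (fun n => ‖fourierCoeff f n‖ ^ 2) (‖f‖ ^ 2) := by
  have h := lp.hasSum_norm (p := 2) (by norm_num) ((fourierBasis (T := 2 * Real.pi)).repr f)
  simpa only [fourierBasis_repr, LinearIsometryEquiv.norm_map, ENNReal.toReal_ofNat,
    Real.rpow_ofNat] using h

theorem norm_le_of_fourierCoeff_le {f g : L2T} {c : ℝ} (hc : 0 ≤ c)
    (h : ∀ n, ‖fourierCoeff f n‖ ≤ c * ‖fourierCoeff g n‖) : ‖f‖ ≤ c * ‖g‖ := by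
  refine le_of_sq_le_sq ?_ (by positivity)
  rw [mul_pow]
  refine hasSum_le (fun n => ?_) (hasSum_norm_sq f) ((hasSum_norm_sq g).mul_left (c ^ 2))
  rw [← mul_pow]
  exact pow_le_pow_left₀ (norm_nonneg _) (h n) 2

section Bounded

variable {s : ℤ → ℂ} {c : ℝ}

theorem memℓp_mul {a : ℤ → ℂ} (hs : ∀ n, ‖s n‖ ≤ c) (ha : Memℓp a 2) :
    Memℓp (fun n => s n * a n) 2 := by
  have hsum : Summable fun n => ‖a n‖ ^ (2 : ℝ) := by
    simpa only [ENNReal.toReal_ofNat] using ha.summable (by norm_num)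
  refine memℓp_gen (.of_nonneg_of_le (fun n => by positivity) (fun n => ?_)
    (hsum.mul_left (c ^ 2)))
  rw [ENNReal.toReal_ofNat, Real.rpow_ofNat, Real.rpow_ofNat, norm_mul, mul_pow]
  gcongr
  exact hs n

theorem fourierCoeff_ofCoeff_mul (hs : ∀ n, ‖s n‖ ≤ c) (f : L2T) (n : ℤ) :
    fourierCoeff (ofCoeff fun n => s n * fourierCoeff f n) n = s n * fourierCoeff f n :=
  fourierCoeff_ofCoeff (memℓp_mul hs (memℓp_fourierCoeff f)) n

open Classical in
/-- The Fourier multiplier `f_n ↦ s n * f_n` with a bounded symbol `s` (zero if `s` is not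
bounded). -/
def fourierMultiplier (s : ℤ → ℂ) : L2T →L[ℂ] L2T :=
  if hs : ∃ c, ∀ n, ‖s n‖ ≤ c then
    LinearMap.mkContinuousOfExistsBound
      { toFun := fun f => ofCoeff fun n => s n * fourierCoeff f n
        map_add' := fun f g => fourierCoeff_ext fun n => by
          rw [fourierCoeff_coe_add, fourierCoeff_ofCoeff_mul hs.choose_spec,
            fourierCoeff_ofCoeff_mul hs.choose_spec, fourierCoeff_ofCoeff_mul hs.choose_spec,
            fourierCoeff_coe_add, mul_add]
        map_smul' := fun a f => fourierCoeff_ext fun n => by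
          rw [RingHom.id_apply, fourierCoeff_coe_smul, fourierCoeff_ofCoeff_mul hs.choose_spec,
            fourierCoeff_ofCoeff_mul hs.choose_spec, fourierCoeff_coe_smul, mul_left_comm] }
      ⟨hs.choose, fun f =>
        norm_le_of_fourierCoeff_le ((norm_nonneg _).trans (hs.choose_spec 0)) fun n => by
          change ‖fourierCoeff (ofCoeff fun n => s n * fourierCoeff f n) n‖ ≤ _
          rw [fourierCoeff_ofCoeff_mul hs.choose_spec, norm_mul]
          exact mul_le_mul_of_nonneg_right (hs.choose_spec n) (norm_nonneg _)⟩
  else 0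

theorem fourierCoeff_fourierMultiplier (hs : ∀ n, ‖s n‖ ≤ c) (f : L2T) (n : ℤ) :
    fourierCoeff (fourierMultiplier s f) n = s n * fourierCoeff f n := by
  rw [fourierMultiplier, dif_pos ⟨c, hs⟩]
  exact fourierCoeff_ofCoeff_mul hs f n

theorem norm_fourierMultiplier_le (hs : ∀ n, ‖s n‖ ≤ c) : ‖fourierMultiplier s‖ ≤ c := by
  have hc : 0 ≤ c := (norm_nonneg _).trans (hs 0)
  refine ContinuousLinearMap.opNorm_le_bound _ hc fun f => norm_le_of_fourierCoeff_le hc fun n => ?_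
  rw [fourierCoeff_fourierMultiplier hs, norm_mul]
  exact mul_le_mul_of_nonneg_right (hs n) (norm_nonneg _)

/-- The Fourier multiplier with symbol `s`, an isomorphism when `s` and `1 / s` are bounded. -/
def fourierMultiplierEquiv (s : ℤ → ℂ) {c c' : ℝ} (hs : ∀ n, ‖s n‖ ≤ c)
    (hs' : ∀ n, ‖(s n)⁻¹‖ ≤ c') (hne : ∀ n, s n ≠ 0) : L2T ≃L[ℂ] L2T :=
  ContinuousLinearEquiv.equivOfInverse (fourierMultiplier s) (fourierMultiplier fun n => (s n)⁻¹)
    (fun f => fourierCoeff_ext fun n => by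
      rw [fourierCoeff_fourierMultiplier hs', fourierCoeff_fourierMultiplier hs,
        inv_mul_cancel_left₀ (hne n)])
    (fun f => fourierCoeff_ext fun n => by
      rw [fourierCoeff_fourierMultiplier hs, fourierCoeff_fourierMultiplier hs',
        mul_inv_cancel_left₀ (hne n)])

/-- The truncation of the Fourier multiplier with symbol `s` to the frequencies in `F`. -/
def truncatedMultiplier (s : ℤ → ℂ) (F : Finset ℤ) : L2T →L[ℂ] L2T :=
  ∑ n ∈ F, s n • (coeffL n).smulRight (fourierBasis (T := 2 * Real.pi) n : L2T)

theorem fourierCoeff_truncatedMultiplier (s : ℤ → ℂ) (F : Finset ℤ) (f : L2T) (n : ℤ) :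
    fourierCoeff (truncatedMultiplier s F f) n = if n ∈ F then s n * fourierCoeff f n else 0 := by
  simp only [truncatedMultiplier, ← coeffL_apply, sum_apply, map_sum, smul_apply,
    ContinuousLinearMap.smulRight_apply, map_smul, smul_eq_mul]
  simp only [coeffL_apply, fourierCoeff_fourierBasis, mul_ite, mul_one, mul_zero,
    Finset.sum_ite_eq]

theorem isCompactOperator_truncatedMultiplier (s : ℤ → ℂ) (F : Finset ℤ) :
    IsCompactOperator (truncatedMultiplier s F) := by
  classical
  induction F using Finset.induction_on with
  | empty => simpa [truncatedMultiplier] using isCompactOperator_zero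
  | insert a F ha ih =>
    rw [truncatedMultiplier, Finset.sum_insert ha]
    have hrank :
        IsCompactOperator ((coeffL a).smulRight (fourierBasis (T := 2 * Real.pi) a : L2T)) :=
      (isCompactOperator_of_locallyCompactSpace_rng
        (ContinuousLinearMap.toSpanSingleton ℂ (fourierBasis (T := 2 * Real.pi) a : L2T))).comp_clm
          (coeffL a)
    exact (hrank.smul (s a)).add ih

theorem isCompactOperator_fourierMultiplier (hs : Filter.Tendsto s Filter.cofinite (nhds 0)) :
    IsCompactOperator (fourierMultiplier s) := by
  obtain ⟨c, hc⟩ := hs.norm.bddAbove_range_of_cofinite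
  rw [mem_upperBounds, Set.forall_mem_range] at hc
  refine isCompactOperator_of_tendsto (l := Filter.atTop) (F := truncatedMultiplier s) ?_
    (Filter.Eventually.of_forall (isCompactOperator_truncatedMultiplier s))
  rw [Metric.tendsto_atTop]
  intro ε hε
  have hfin : {n | ¬ ‖s n‖ < ε / 2}.Finite :=
    hs.norm.eventually_lt_const (by rw [norm_zero]; exact half_pos hε)
  refine ⟨hfin.toFinset, fun F hF => ?_⟩
  rw [dist_eq_norm]
  refine (ContinuousLinearMap.opNorm_le_bound _ (half_pos hε).le fun f =>
    norm_le_of_fourierCoeff_le (half_pos hε).le fun n => ?_).trans_lt (half_lt_self hε)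
  rw [sub_apply, fourierCoeff_coe_sub, fourierCoeff_truncatedMultiplier,
    fourierCoeff_fourierMultiplier hc]
  split_ifs with hn
  · rw [sub_self, norm_zero]
    positivity
  · rw [zero_sub, norm_neg, norm_mul]
    refine mul_le_mul_of_nonneg_right (not_lt.1 fun h => hn (hF ?_)) (norm_nonneg _)
    exact hfin.mem_toFinset.2 h.le.not_gt

end Bounded

section Unbounded

variable {σ : ℤ → ℂ} {z : ℂ}

/-- The maximal domain of the Fourier multiplier with symbol `σ`. -/
def multiplierDomain (σ : ℤ → ℂ) : Submodule ℂ L2T where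
  carrier := {f | Memℓp (fun n => σ n * fourierCoeff f n) 2}
  zero_mem' := by
    have h : (fun n => σ n * fourierCoeff (0 : L2T) n) = 0 := funext fun n => by
      rw [← coeffL_apply, map_zero, mul_zero, Pi.zero_apply]
    exact h.substr (p := (Memℓp · 2)) zero_memℓp
  add_mem' {f g} hf hg := by
    have h : (fun n => σ n * fourierCoeff (f + g : L2T) n)
        = (fun n => σ n * fourierCoeff f n) + fun n => σ n * fourierCoeff g n :=
      funext fun n => by rw [fourierCoeff_coe_add, mul_add, Pi.add_apply]
    exact h.substr (p := (Memℓp · 2)) (Memℓp.add hf hg)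
  smul_mem' a f hf := by
    have h : (fun n => σ n * fourierCoeff (a • f : L2T) n)
        = a • fun n => σ n * fourierCoeff f n :=
      funext fun n => by rw [fourierCoeff_coe_smul, mul_left_comm, Pi.smul_apply, smul_eq_mul]
    exact h.substr (p := (Memℓp · 2)) (Memℓp.const_smul hf a)

/-- The unbounded Fourier multiplier `f_n ↦ σ n * f_n` on its maximal domain. -/
def unboundedMultiplier (σ : ℤ → ℂ) : L2T →ₗ.[ℂ] L2T where
  domain := multiplierDomain σ
  toFun :=
    { toFun := fun f => ofCoeff fun n => σ n * fourierCoeff (f : L2T) n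
      map_add' := fun f g => fourierCoeff_ext fun n => by
        rw [fourierCoeff_coe_add, fourierCoeff_ofCoeff (f + g).2, fourierCoeff_ofCoeff f.2,
          fourierCoeff_ofCoeff g.2, Submodule.coe_add, fourierCoeff_coe_add, mul_add]
      map_smul' := fun a f => fourierCoeff_ext fun n => by
        rw [RingHom.id_apply, fourierCoeff_coe_smul, fourierCoeff_ofCoeff (a • f).2,
          fourierCoeff_ofCoeff f.2, Submodule.coe_smul, fourierCoeff_coe_smul, mul_left_comm] }

theorem mem_graph_unboundedMultiplier {h r : L2T} :
    (h, r) ∈ (unboundedMultiplier σ).graph ↔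
      ∀ n, fourierCoeff r n = σ n * fourierCoeff h n := by
  rw [LinearPMap.mem_graph_iff]
  refine ⟨?_, fun hr => ?_⟩
  · rintro ⟨f, rfl, rfl⟩ n
    exact fourierCoeff_ofCoeff f.2 n
  · have hmem : Memℓp (fun n => σ n * fourierCoeff h n) 2 := by
      simpa only [hr] using memℓp_fourierCoeff r
    exact ⟨⟨h, hmem⟩, rfl, fourierCoeff_ext fun n => by
      rw [hr]; exact fourierCoeff_ofCoeff hmem n⟩

theorem isResolvent_unboundedMultiplier {c : ℝ} (hσ : ∀ n, σ n ≠ z)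
    (hc : ∀ n, ‖(σ n - z)⁻¹‖ ≤ c) :
    IsResolvent (unboundedMultiplier σ) z (fourierMultiplier fun n => (σ n - z)⁻¹) := by
  refine ⟨fun g => mem_graph_unboundedMultiplier.2 fun n => ?_, fun h r hr =>
    fourierCoeff_ext fun n => ?_⟩
  · rw [fourierCoeff_coe_add, fourierCoeff_coe_smul, fourierCoeff_fourierMultiplier hc]
    have := sub_ne_zero.2 (hσ n)
    field_simp
    ring
  · rw [fourierCoeff_fourierMultiplier hc, fourierCoeff_coe_sub, fourierCoeff_coe_smul,
      mem_graph_unboundedMultiplier.1 hr, ← sub_mul, inv_mul_cancel_left₀ (sub_ne_zero.2 (hσ n))]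

/-- The inverse of `σ - z` away from the frequency `m`. -/
def reducedResolvent (σ : ℤ → ℂ) (m : ℤ) (z : ℂ) : L2T →L[ℂ] L2T :=
  fourierMultiplier fun n => if n = m then 0 else (σ n - z)⁻¹

theorem isSpectralSplitting_unboundedMultiplier {m : ℤ} {s : Set ℂ} {ρ : ℝ} (hρ : 0 < ρ)
    (hgap : ∀ z ∈ s, ∀ n ≠ m, ρ⁻¹ ≤ ‖σ n - z‖) :
    IsSpectralSplitting (unboundedMultiplier σ) (σ m) (fourierBasis (T := 2 * Real.pi) m)
      (coeffL m) s (reducedResolvent σ m) ρ := by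
  have hbound {z} (hz : z ∈ s) (n : ℤ) : ‖if n = m then 0 else (σ n - z)⁻¹‖ ≤ ρ := by
    split_ifs with hn
    · rw [norm_zero]; exact hρ.le
    · rw [norm_inv]; exact inv_le_of_inv_le₀ hρ (hgap z hz n hn)
  have hcoeff {z} (hz : z ∈ s) := fourierCoeff_fourierMultiplier (hbound hz)
  have hne {z} (hz : z ∈ s) {n} (hn : n ≠ m) : σ n - z ≠ 0 :=
    norm_pos_iff.1 ((inv_pos.2 hρ).trans_le (hgap z hz n hn))
  have hnorm := (fourierBasis (T := 2 * Real.pi)).orthonormal.1 m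
  exact
    { mem_graph := mem_graph_unboundedMultiplier.2 fun n => by
        rw [fourierCoeff_coe_smul, fourierCoeff_fourierBasis]
        split_ifs with hn
        · rw [hn]
        · simp only [mul_zero]
      map_graph := fun hr => by
        rw [coeffL_apply, coeffL_apply, mem_graph_unboundedMultiplier.1 hr]
      map_self := by rw [coeffL_apply, fourierCoeff_fourierBasis, if_pos rfl]
      norm_le_one := hnorm.le
      norm_functional_le_one := by rw [coeffL, innerSL_apply_norm, hnorm]
      resolvent_mem := fun hz f => mem_graph_unboundedMultiplier.2 fun n => by
        rw [reducedResolvent, fourierCoeff_coe_add, fourierCoeff_coe_sub, fourierCoeff_coe_smul,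
          fourierCoeff_coe_smul, fourierCoeff_fourierBasis, hcoeff hz, coeffL_apply]
        split_ifs with hn
        · rw [hn]; ring
        · have := hne hz hn
          field_simp
          ring
      resolvent_sub := fun hz h r hr => fourierCoeff_ext fun n => by
        rw [reducedResolvent, hcoeff hz, fourierCoeff_coe_sub, fourierCoeff_coe_sub,
          fourierCoeff_coe_smul, fourierCoeff_coe_smul, fourierCoeff_fourierBasis, coeffL_apply,
          mem_graph_unboundedMultiplier.1 hr, ← sub_mul]
        split_ifs with hn
        · rw [hn]; ring
        · rw [inv_mul_cancel_left₀ (hne hz hn), mul_zero, sub_zero]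
      map_resolvent := fun hz f => by
        rw [reducedResolvent, coeffL_apply, hcoeff hz, if_pos rfl, zero_mul]
      norm_resolvent_le := fun hz => norm_fourierMultiplier_le (hbound hz) }

end Unbounded

/-! ### Multiplication operators -/

/-- Multiplication by an essentially bounded function `W`. -/
def mulOp (W : L2T) (hW : MemLp W ⊤ tmeas) : L2T →L[ℂ] L2T :=
  (ContinuousLinearMap.mul ℂ ℂ).holderL tmeas ⊤ 2 2 (hW.toLp W)

theorem coeFn_mulOp (W : L2T) (hW : MemLp W ⊤ tmeas) (f : L2T) :
    mulOp W hW f =ᵐ[tmeas] fun y => W y * f y := by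
  have h := ContinuousLinearMap.coeFn_holder (r := 2) (ContinuousLinearMap.mul ℂ ℂ) (hW.toLp W) f
  filter_upwards [h, hW.coeFn_toLp] with y hy hWy
  change ((ContinuousLinearMap.mul ℂ ℂ).holder 2 (hW.toLp W) f) y = _
  rw [hy, hWy, ContinuousLinearMap.mul_apply']

theorem norm_mulOp_le {W : L2T} (hW : MemLp W ⊤ tmeas) {c : ℝ} (hc : 0 ≤ c)
    (h : ∀ᵐ y ∂tmeas, ‖W y‖ ≤ c) : ‖mulOp W hW‖ ≤ c := by
  refine ContinuousLinearMap.opNorm_le_bound _ hc fun f => Lp.norm_le_mul_norm_of_ae_le_mul ?_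
  filter_upwards [coeFn_mulOp W hW f, h] with y hy hWy
  rw [hy, norm_mul]
  exact mul_le_mul_of_nonneg_right hWy (norm_nonneg _)

/-- The constant function `1`. -/
abbrev constOne : L2T := fourierBasis (T := 2 * Real.pi) 0

theorem norm_constOne : ‖constOne‖ = 1 := (fourierBasis (T := 2 * Real.pi)).orthonormal.1 0

theorem coeFn_constOne : constOne =ᵐ[tmeas] fun _ => (1 : ℂ) := by
  rw [constOne, coe_fourierBasis]
  filter_upwards [coeFn_fourierLp (T := 2 * Real.pi) 2 0] with y hy
  rw [hy, fourier_zero]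

theorem mulOp_constOne (W : L2T) (hW : MemLp W ⊤ tmeas) : mulOp W hW constOne = W := by
  refine Lp.ext ?_
  filter_upwards [coeFn_mulOp W hW constOne, coeFn_constOne] with y hy hone
  rw [hy, hone, mul_one]

theorem norm_fourierCoeff_le (f : L2T) (n : ℤ) : ‖fourierCoeff f n‖ ≤ ‖f‖ := by
  rw [← fourierBasis_repr]
  exact (lp.norm_apply_le_norm two_ne_zero _ n).trans_eq (LinearIsometryEquiv.norm_map _ f)

theorem fourierCoeff_zero_eq_integral (f : L2T) : fourierCoeff f 0 = ∫ y, f y ∂tmeas := by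
  simp only [fourierCoeff, neg_zero, fourier_zero, one_smul]

theorem fourierCoeff_star (W : L2T) (n : ℤ) :
    fourierCoeff (star W : L2T) n = star (fourierCoeff W (-n)) := by
  rw [fourierCoeff_congr_ae (Lp.coeFn_star W), fourierCoeff, fourierCoeff,
    ← starRingEnd_apply (R := ℂ), ← integral_conj]
  refine integral_congr_ae (Filter.Eventually.of_forall fun y => ?_)
  simp

theorem fourierCoeff_neg_of_real {U : L2T} (hU : ∀ᵐ y ∂tmeas, (U y).im = 0) (n : ℤ) :
    fourierCoeff U (-n) = star (fourierCoeff U n) := by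
  have h : star U = U := by
    refine Lp.ext ?_
    filter_upwards [Lp.coeFn_star U, hU] with y hy him
    rw [hy]
    exact Complex.conj_eq_iff_im.2 him
  conv_lhs => rw [← h]
  rw [fourierCoeff_star, neg_neg]

theorem hasSum_fourierCoeff_mulOp_zero (W : L2T) (hW : MemLp W ⊤ tmeas) (f : L2T) :
    HasSum (fun n => fourierCoeff W (-n) * fourierCoeff f n) (fourierCoeff (mulOp W hW f) 0) := by
  have h := (fourierBasis (T := 2 * Real.pi)).hasSum_inner_mul_inner (star W) f
  have hmean : inner ℂ (star W) f = fourierCoeff (mulOp W hW f) 0 := by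
    rw [L2.inner_def, fourierCoeff_zero_eq_integral]
    refine integral_congr_ae ?_
    filter_upwards [Lp.coeFn_star W, coeFn_mulOp W hW f] with y hstar hmul
    rw [hstar, hmul]
    simp [mul_comm]
  rw [hmean] at h
  refine h.congr_fun fun n => ?_
  rw [← HilbertBasis.repr_apply_apply, fourierBasis_repr, ← inner_conj_symm,
    ← HilbertBasis.repr_apply_apply, fourierBasis_repr, fourierCoeff_star, starRingEnd_apply,
    star_star]

/-! ### The conjugated transport operator -/

/-- The symbol of `∂_yy - β²`. -/
def modeSymbol (β : ℝ) (n : ℤ) : ℂ := -((β ^ 2 + (n : ℝ) ^ 2 : ℝ) : ℂ)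

theorem norm_modeSymbol (β : ℝ) (n : ℤ) : ‖modeSymbol β n‖ = β ^ 2 + (n : ℝ) ^ 2 := by
  rw [modeSymbol, norm_neg, Complex.norm_real, Real.norm_of_nonneg (by positivity)]

theorem one_le_sq_intCast {n : ℤ} (hn : n ≠ 0) : 1 ≤ (n : ℝ) ^ 2 :=
  (one_le_sq_iff_one_le_abs _).2 (by exact_mod_cast Int.one_le_abs hn)

theorem one_le_norm_modeSymbol (β : ℝ) {n : ℤ} (hn : n ≠ 0) : 1 ≤ ‖modeSymbol β n‖ := by
  rw [norm_modeSymbol]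
  exact (one_le_sq_intCast hn).trans (le_add_of_nonneg_left (sq_nonneg β))

theorem modeSymbol_ne_zero (β : ℝ) {n : ℤ} (hn : n ≠ 0) : modeSymbol β n ≠ 0 :=
  norm_pos_iff.1 (one_pos.trans_le (one_le_norm_modeSymbol β hn))

/-- The stream function `ψ` and the vorticity `(∂_yy - β²) ψ` of a mode are both determined by
the function `h` whose mean is that of `ψ` and whose other frequencies are those of the
vorticity. This is the symbol of `h ↦ ψ`. -/
def streamSymbol (β : ℝ) (n : ℤ) : ℂ := if n = 0 then 1 else (modeSymbol β n)⁻¹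

/-- The symbol of the map from `h` to the vorticity, see `streamSymbol`. -/
def vorticitySymbol (β : ℝ) (n : ℤ) : ℂ := if n = 0 then modeSymbol β 0 else 1

theorem modeSymbol_mul_streamSymbol (β : ℝ) (n : ℤ) :
    modeSymbol β n * streamSymbol β n = vorticitySymbol β n := by
  rw [streamSymbol, vorticitySymbol]
  split_ifs with hn
  · rw [hn, mul_one]
  · exact mul_inv_cancel₀ (modeSymbol_ne_zero β hn)

theorem norm_streamSymbol_le (β : ℝ) (n : ℤ) : ‖streamSymbol β n‖ ≤ 1 := by
  rw [streamSymbol]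
  split_ifs with hn
  · exact norm_one.le
  · rw [norm_inv]
    exact inv_le_one_of_one_le₀ (one_le_norm_modeSymbol β hn)

theorem norm_vorticitySymbol_le {β : ℝ} (hβ : β ^ 2 ≤ 1) (n : ℤ) :
    ‖vorticitySymbol β n‖ ≤ 1 := by
  rw [vorticitySymbol]
  split_ifs with hn
  · simpa only [norm_modeSymbol, Int.cast_zero, ne_eq, OfNat.ofNat_ne_zero, not_false_eq_true,
      zero_pow, add_zero] using hβ
  · exact norm_one.le

/-- The stream function of `h`, see `streamSymbol`. -/
def stream (β : ℝ) : L2T →L[ℂ] L2T := fourierMultiplier (streamSymbol β)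

/-- The vorticity of `h`, see `streamSymbol`. -/
def vorticity (β : ℝ) : L2T →L[ℂ] L2T := fourierMultiplier (vorticitySymbol β)

theorem fourierCoeff_stream (β : ℝ) (h : L2T) (n : ℤ) :
    fourierCoeff (stream β h) n = streamSymbol β n * fourierCoeff h n :=
  fourierCoeff_fourierMultiplier (norm_streamSymbol_le β) h n

theorem norm_stream_le (β : ℝ) : ‖stream β‖ ≤ 1 :=
  norm_fourierMultiplier_le (norm_streamSymbol_le β)

theorem fourierCoeff_vorticity {β : ℝ} (hβ : β ^ 2 ≤ 1) (h : L2T) (n : ℤ) :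
    fourierCoeff (vorticity β h) n = vorticitySymbol β n * fourierCoeff h n :=
  fourierCoeff_fourierMultiplier (norm_vorticitySymbol_le hβ) h n

theorem norm_vorticity_le {β : ℝ} (hβ : β ^ 2 ≤ 1) : ‖vorticity β‖ ≤ 1 :=
  norm_fourierMultiplier_le (norm_vorticitySymbol_le hβ)

theorem stream_constOne (β : ℝ) : stream β constOne = constOne := fourierCoeff_ext fun n => by
  rw [fourierCoeff_stream, fourierCoeff_fourierBasis, streamSymbol]
  split_ifs
  · rw [mul_one]
  · rw [mul_zero]

theorem vorticity_constOne {β : ℝ} (hβ : β ^ 2 ≤ 1) :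
    vorticity β constOne = modeSymbol β 0 • constOne := fourierCoeff_ext fun n => by
  rw [fourierCoeff_vorticity hβ, fourierCoeff_coe_smul, fourierCoeff_fourierBasis, vorticitySymbol]
  split_ifs
  · rfl
  · rw [mul_zero, mul_zero]

theorem vorticity_of_meanFree {β : ℝ} (hβ : β ^ 2 ≤ 1) {h : L2T} (hh : fourierCoeff h 0 = 0) :
    vorticity β h = h := fourierCoeff_ext fun n => by
  rw [fourierCoeff_vorticity hβ, vorticitySymbol]
  split_ifs with hn
  · rw [hn, hh, mul_zero]
  · rw [one_mul]

/-- The projection onto the mean-free functions. -/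
def meanFree : L2T →L[ℂ] L2T := fourierMultiplier fun n => if n = 0 then 0 else 1

theorem norm_meanFreeSymbol_le (n : ℤ) : ‖(if n = 0 then 0 else 1 : ℂ)‖ ≤ 1 := by
  split_ifs <;> simp

theorem fourierCoeff_meanFree (f : L2T) (n : ℤ) :
    fourierCoeff (meanFree f) n = if n = 0 then 0 else fourierCoeff f n := by
  rw [meanFree, fourierCoeff_fourierMultiplier norm_meanFreeSymbol_le, ite_mul, zero_mul, one_mul]

theorem norm_meanFree_le : ‖meanFree‖ ≤ 1 := norm_fourierMultiplier_le norm_meanFreeSymbol_le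

section Transport

variable {U W : L2T} (hU : MemLp U ⊤ tmeas) (hW : MemLp W ⊤ tmeas) (β : ℝ)

/-- For `W = U''`, the operator `ω ↦ U ω - U'' ψ` on the vorticity `ω` of a mode with stream
function `ψ`, conjugated by `vorticity β`. The conjugation removes the factor `β⁻²` which the
mean of `ω` carries in `ψ`. -/
def transportOp : L2T →L[ℂ] L2T :=
  meanFree ∘L (mulOp U hU ∘L vorticity β - mulOp W hW ∘L stream β)
    + (coeffL 0 ∘L mulOp U hU ∘L stream β).smulRight constOne

theorem transportOp_apply (h : L2T) : transportOp hU hW β h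
    = meanFree (mulOp U hU (vorticity β h) - mulOp W hW (stream β h))
      + fourierCoeff (mulOp U hU (stream β h)) 0 • constOne := by
  rw [← coeffL_apply]
  rfl

theorem fourierCoeff_transportOp_zero (h : L2T) :
    fourierCoeff (transportOp hU hW β h) 0 = fourierCoeff (mulOp U hU (stream β h)) 0 := by
  rw [transportOp_apply, fourierCoeff_coe_add, fourierCoeff_meanFree, if_pos rfl,
    fourierCoeff_coe_smul, fourierCoeff_fourierBasis, if_pos rfl, mul_one, zero_add]

theorem fourierCoeff_transportOp_of_ne {n : ℤ} (hn : n ≠ 0) (h : L2T) :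
    fourierCoeff (transportOp hU hW β h) n
      = fourierCoeff (mulOp U hU (vorticity β h)) n - fourierCoeff (mulOp W hW (stream β h)) n := by
  rw [transportOp_apply, fourierCoeff_coe_add, fourierCoeff_meanFree, if_neg hn,
    fourierCoeff_coe_sub, fourierCoeff_coe_smul, fourierCoeff_fourierBasis, if_neg hn, mul_zero,
    add_zero]

variable {β}

theorem norm_transportOp_le {w : ℝ} (hUw : ‖mulOp U hU‖ ≤ w) (hWw : ‖mulOp W hW‖ ≤ w)
    (hβ : β ^ 2 ≤ 1) : ‖transportOp hU hW β‖ ≤ 3 * w := by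
  have hw : 0 ≤ w := (norm_nonneg _).trans hUw
  have hcomp {A B : L2T →L[ℂ] L2T} (hA : ‖A‖ ≤ w) (hB : ‖B‖ ≤ 1) : ‖A ∘L B‖ ≤ w := by
    simpa only [mul_one] using
      (A.opNorm_comp_le B).trans (mul_le_mul hA hB (norm_nonneg _) hw)
  have hmean : ‖(coeffL 0 ∘L mulOp U hU ∘L stream β).smulRight constOne‖ ≤ w := by
    rw [ContinuousLinearMap.norm_smulRight_apply, norm_constOne, mul_one]
    refine ContinuousLinearMap.opNorm_le_bound _ hw fun h => ?_
    exact (coeffL_apply 0 _ ▸ norm_fourierCoeff_le _ 0).trans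
      ((mulOp U hU ∘L stream β).le_of_opNorm_le (hcomp hUw (norm_stream_le β)) h)
  calc ‖transportOp hU hW β‖
      ≤ 1 * (w + w) + w := by
        refine norm_add_le_of_le ((meanFree.opNorm_comp_le _).trans ?_) hmean
        exact mul_le_mul norm_meanFree_le (norm_sub_le_of_le (hcomp hUw (norm_vorticity_le hβ))
          (hcomp hWw (norm_stream_le β))) (norm_nonneg _) zero_le_one
    _ = 3 * w := by ring

variable (hUW : ∀ n : ℤ, fourierCoeff W n = -((n : ℂ) ^ 2) * fourierCoeff U n)

include hUW

/-- Integration by parts: the mean of `U (ψ'' - β² ψ) - U'' ψ` is that of `-β² U ψ`. -/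
theorem fourierCoeff_transport_zero (hβ : β ^ 2 ≤ 1) (h : L2T) :
    fourierCoeff (mulOp U hU (vorticity β h) - mulOp W hW (stream β h)) 0
      = modeSymbol β 0 * fourierCoeff (mulOp U hU (stream β h)) 0 := by
  rw [fourierCoeff_coe_sub]
  refine ((hasSum_fourierCoeff_mulOp_zero U hU _).sub
    (hasSum_fourierCoeff_mulOp_zero W hW _)).unique
    (((hasSum_fourierCoeff_mulOp_zero U hU _).mul_left (modeSymbol β 0)).congr_fun fun n => ?_)
  rw [fourierCoeff_vorticity hβ, fourierCoeff_stream, hUW, ← modeSymbol_mul_streamSymbol,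
    modeSymbol, modeSymbol]
  push_cast
  ring

theorem vorticity_transportOp (hβ : β ^ 2 ≤ 1) (h : L2T) :
    vorticity β (transportOp hU hW β h)
      = mulOp U hU (vorticity β h) - mulOp W hW (stream β h) := fourierCoeff_ext fun n => by
  rw [fourierCoeff_vorticity hβ, vorticitySymbol]
  split_ifs with hn
  · rw [hn, fourierCoeff_transportOp_zero, fourierCoeff_transport_zero hU hW hUW hβ]
  · rw [one_mul, fourierCoeff_transportOp_of_ne hU hW β hn, fourierCoeff_coe_sub]

theorem fourierCoeff_transportOp_constOne (hU₀ : fourierCoeff U 0 = 0) (hβ : β ^ 2 ≤ 1) (n : ℤ) :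
    fourierCoeff (transportOp hU hW β constOne) n
      = (2 * modeSymbol β 0 - modeSymbol β n) * fourierCoeff U n := by
  obtain rfl | hn := eq_or_ne n 0
  · rw [fourierCoeff_transportOp_zero, stream_constOne, mulOp_constOne, hU₀, mul_zero]
  · rw [fourierCoeff_transportOp_of_ne hU hW β hn, stream_constOne, vorticity_constOne hβ, map_smul,
      mulOp_constOne, mulOp_constOne, fourierCoeff_coe_smul, hUW, modeSymbol, modeSymbol]
    push_cast
    ring

end Transport

/-! ### The modes `e^{ikx} f(y)` -/

theorem coeFn_mode (k : ℤ) (f : L2T) :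
    mode k f =ᵐ[tmeas2] fun p => fourier k p.1 * f p.2 := (memLp_mode k f).coeFn_toLp

theorem coeff2_fourier_mul (k : ℤ) (f : Torus → ℂ) (m n : ℤ) :
    coeff2 (fun p => fourier k p.1 * f p.2) m n = if m = k then fourierCoeff f n else 0 := by
  have hprod : coeff2 (fun p => fourier k p.1 * f p.2) m n
      = fourierCoeff (fourier k : Torus → ℂ) m * fourierCoeff f n := by
    rw [fourierCoeff, fourierCoeff, ← integral_prod_mul, coeff2]
    refine integral_congr_ae (Filter.Eventually.of_forall fun p => ?_)
    simp only [smul_eq_mul]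
    ring
  rw [hprod, fourierCoeff_fourier, Pi.single_apply, ite_mul, one_mul, zero_mul]

theorem coeff2_mode (k : ℤ) (f : L2T) (m n : ℤ) :
    coeff2 (mode k f) m n = if m = k then fourierCoeff f n else 0 := by
  rw [coeff2_congr (coeFn_mode k f), coeff2_fourier_mul]

theorem norm_mode (k : ℤ) (f : L2T) : ‖mode k f‖ = ‖f‖ := by
  have hnorm : eLpNorm (fun p : Torus × Torus => fourier k p.1 * f p.2) 2 tmeas2
      = eLpNorm (f ∘ Prod.snd) 2 tmeas2 :=
    eLpNorm_congr_norm_ae (Filter.Eventually.of_forall fun p => by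
      simp only [fourier_apply, norm_mul, Circle.norm_coe, one_mul, Function.comp_apply])
  rw [Lp.norm_def, Lp.norm_def, eLpNorm_congr_ae (coeFn_mode k f), hnorm,
    eLpNorm_comp_measurePreserving (Lp.aestronglyMeasurable f) measurePreserving_snd]

/-- The map `f ↦ e^{ikx} f(y)` as an isomorphism onto the class. -/
def modeEquiv (k : ℤ) : L2T ≃L[ℂ] modeClass k :=
  (⟨mode k, norm_mode k⟩ : L2T →ₗᵢ[ℂ] L2T2).equivRange.toContinuousLinearEquiv

theorem coe_modeEquiv (k : ℤ) (f : L2T) : (modeEquiv k f : L2T2) = mode k f := rfl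

theorem eq_of_coeff2 {v w : L2T2} (h : ∀ m n, coeff2 v m n = coeff2 w m n) : v = w := by
  refine sub_eq_zero.1 (eq_zero_of_coeff2 _ fun m n => ?_)
  rw [sub_eq_add_neg, ← neg_one_smul ℂ w, coeff2_coe_add, coeff2_coe_smul, h]
  ring

theorem coeff2_transport_mode {U W : L2T} (hU : MemLp U ⊤ tmeas) (hW : MemLp W ⊤ tmeas) (k : ℤ)
    (f ψ : L2T) (m n : ℤ) : coeff2 (transport U W (mode k f) (mode k ψ)) m n
      = if m = k then fourierCoeff (mulOp U hU f - mulOp W hW ψ : L2T) n else 0 := by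
  have hsnd (V : L2T) (hV : MemLp V ⊤ tmeas) (g : L2T) :=
    (Measure.quasiMeasurePreserving_snd (μ := tmeas) (ν := tmeas)).ae_eq_comp (coeFn_mulOp V hV g)
  rw [← coeff2_mode]
  refine coeff2_congr ?_ m n
  rw [map_sub]
  filter_upwards [hsnd U hU f, hsnd W hW ψ, coeFn_mode k f, coeFn_mode k ψ,
    coeFn_mode k (mulOp U hU f), coeFn_mode k (mulOp W hW ψ),
    Lp.coeFn_sub (mode k (mulOp U hU f)) (mode k (mulOp W hW ψ))] with p hUf hWψ hf hψ hkf hkψ hsub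
  simp only [Function.comp_apply] at hUf hWψ
  rw [transport, hf, hψ, hsub, Pi.sub_apply, hkf, hkψ, hUf, hWψ]
  ring

theorem memH2T2_mode_iff (k : ℤ) (f : L2T) : MemH2T2 (mode k f) ↔
    Summable fun n : ℤ => (1 + (k : ℝ) ^ 2 + (n : ℝ) ^ 2) ^ 2 * ‖fourierCoeff f n‖ ^ 2 := by
  have hinj : Function.Injective fun n : ℤ => (k, n) := Prod.mk_right_injective k
  rw [MemH2T2, ← hinj.summable_iff]
  · refine summable_congr fun n => ?_
    rw [Function.comp_apply, coeff2_mode, if_pos rfl]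
  · rintro ⟨m, n⟩ hmn
    have hm : m ≠ k := fun h => hmn ⟨n, by rw [h]⟩
    rw [coeff2_mode, if_neg hm, norm_zero, zero_pow two_ne_zero, mul_zero]

/-- Elliptic regularity: `f ∈ H²` as soon as `(∂_yy - β²) f ∈ L²`. -/
theorem memH2T2_mode {β : ℝ} (hβ : β ≠ 0) (k : ℤ) {f q : L2T}
    (hq : ∀ n, fourierCoeff q n = modeSymbol β n * fourierCoeff f n) : MemH2T2 (mode k f) := by
  rw [memH2T2_mode_iff]
  set c := (1 + (k : ℝ) ^ 2) / β ^ 2 + 1 with hc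
  refine .of_nonneg_of_le (fun n => by positivity) (fun n => ?_)
    ((hasSum_norm_sq q).summable.mul_left (c ^ 2))
  have hweight : 1 + (k : ℝ) ^ 2 + (n : ℝ) ^ 2 ≤ c * ‖modeSymbol β n‖ := by
    have hexpand : c * ‖modeSymbol β n‖ = 1 + (k : ℝ) ^ 2 + (n : ℝ) ^ 2
        + ((1 + (k : ℝ) ^ 2) / β ^ 2 * (n : ℝ) ^ 2 + β ^ 2) := by
      rw [norm_modeSymbol, hc]
      field_simp
      ring
    rw [hexpand]
    exact le_add_of_nonneg_right (by positivity)
  rw [hq, norm_mul, mul_pow, ← mul_assoc, ← mul_pow c]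
  gcongr

section Class

variable {α : ℝ}

theorem lapSymbol_ne_zero (hα : α ≠ 0) {m n : ℤ} (hmn : (m, n) ≠ (0, 0)) :
    lapSymbol α m n ≠ 0 := by
  rw [lapSymbol, neg_ne_zero, Complex.ofReal_ne_zero]
  obtain rfl | hn := eq_or_ne n 0
  · have hm : (m : ℝ) ≠ 0 := Int.cast_ne_zero.2 fun h => hmn (by rw [h])
    positivity
  · have : (n : ℝ) ≠ 0 := Int.cast_ne_zero.2 hn
    positivity

theorem eq_of_isStream (hα : α ≠ 0) {w ψ ψ' : L2T2} (h : IsStream α w ψ)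
    (h' : IsStream α w ψ') : ψ = ψ' := eq_of_coeff2 fun m n => by
  by_cases hmn : (m, n) = (0, 0)
  · obtain ⟨rfl, rfl⟩ := Prod.mk.inj hmn
    rw [h.1, h'.1]
  · exact mul_left_cancel₀ (lapSymbol_ne_zero hα hmn) ((h.2 m n hmn).trans (h'.2 m n hmn).symm)

variable {k : ℤ} {f ψ : L2T}

theorem isStream_mode (hk : k ≠ 0)
    (hψ : ∀ n, fourierCoeff f n = modeSymbol (α * k) n * fourierCoeff ψ n) :
    IsStream α (mode k f) (mode k ψ) := by
  refine ⟨by rw [coeff2_mode, if_neg hk.symm], fun m n _ => ?_⟩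
  rw [coeff2_mode, coeff2_mode]
  split_ifs with hm
  · rw [hm, hψ, lapSymbol, modeSymbol]
  · rw [mul_zero]

theorem mode_mem_graph_iff {U : L2T} (hU : MemLp U ⊤ tmeas) (hW : MemLp (deriv2 U) ⊤ tmeas)
    {ν : ℝ} (hν : ν ≠ 0) (hα : α ≠ 0) (hk : k ≠ 0) {g : L2T}
    (hψ : ∀ n, fourierCoeff f n = modeSymbol (α * k) n * fourierCoeff ψ n) :
    (mode k f, mode k g) ∈ graph U ν α ↔
      ∀ n, fourierCoeff g n = ν * (modeSymbol (α * k) n * fourierCoeff f n)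
        - α * (Complex.I * k * fourierCoeff (mulOp U hU f - mulOp (deriv2 U) hW ψ : L2T) n) := by
  have hstream := isStream_mode hk hψ
  constructor
  · rintro ⟨-, ψ', hψ', h⟩ n
    rw [eq_of_isStream hα hψ' hstream] at h
    simpa only [coeff2_mode, coeff2_transport_mode hU hW, if_true, lapSymbol, modeSymbol]
      using h k n
  · intro h
    refine ⟨?_, mode k ψ, hstream, fun m n => ?_⟩
    · have hν' : (ν : ℂ) ≠ 0 := Complex.ofReal_ne_zero.2 hν
      refine memH2T2_mode (mul_ne_zero hα (Int.cast_ne_zero.2 hk)) k (q := (ν : ℂ)⁻¹ •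
        (g + (α * (Complex.I * k)) • (mulOp U hU f - mulOp (deriv2 U) hW ψ))) fun n => ?_
      rw [fourierCoeff_coe_smul, fourierCoeff_coe_add, fourierCoeff_coe_smul, h n,
        inv_mul_eq_iff_eq_mul₀ hν']
      ring
    · simp only [coeff2_mode, coeff2_transport_mode hU hW]
      split_ifs with hm
      · rw [hm, h n, lapSymbol, modeSymbol]
      · simp only [mul_zero, sub_zero]

end Class

section Conjugation

variable {β : ℝ}

theorem vorticitySymbol_ne_zero (hβ₀ : β ≠ 0) (n : ℤ) : vorticitySymbol β n ≠ 0 := by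
  rw [vorticitySymbol]
  split_ifs
  · rw [modeSymbol, neg_ne_zero, Complex.ofReal_ne_zero]
    positivity
  · exact one_ne_zero

theorem norm_vorticitySymbol_inv_le (hβ₀ : β ≠ 0) (hβ : β ^ 2 ≤ 1) (n : ℤ) :
    ‖(vorticitySymbol β n)⁻¹‖ ≤ (β ^ 2)⁻¹ := by
  rw [vorticitySymbol, norm_inv]
  split_ifs
  · rw [norm_modeSymbol, Int.cast_zero, zero_pow two_ne_zero, add_zero]
  · rw [norm_one]
    exact inv_anti₀ (by positivity) hβ

/-- The map `vorticity β` as an isomorphism. -/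
def vorticityEquiv (hβ₀ : β ≠ 0) (hβ : β ^ 2 ≤ 1) : L2T ≃L[ℂ] L2T :=
  fourierMultiplierEquiv (vorticitySymbol β) (norm_vorticitySymbol_le hβ)
    (norm_vorticitySymbol_inv_le hβ₀ hβ) (vorticitySymbol_ne_zero hβ₀)

theorem vorticityEquiv_apply (hβ₀ : β ≠ 0) (hβ : β ^ 2 ≤ 1) (h : L2T) :
    vorticityEquiv hβ₀ hβ h = vorticity β h := rfl

/-- The bounded part of the Orr–Sommerfeld operator on a mode after conjugation by `vorticity β`
and division by `ν`, with `ε = β / ν`. -/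
def scaledTransport {U W : L2T} (hU : MemLp U ⊤ tmeas) (hW : MemLp W ⊤ tmeas) (β ε : ℝ) :
    L2T →L[ℂ] L2T :=
  -(Complex.I * ε) • transportOp hU hW β

/-- The Orr–Sommerfeld operator on a mode after conjugation by `vorticity β` and division by `ν`,
with `ε = β / ν`. -/
def conjugatedMode {U W : L2T} (hU : MemLp U ⊤ tmeas) (hW : MemLp W ⊤ tmeas) (β ε : ℝ) :
    L2T →ₗ.[ℂ] L2T :=
  (scaledTransport hU hW β ε : L2T →ₗ[ℂ] L2T) +ᵥ unboundedMultiplier (modeSymbol β)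

theorem isSimilarBy_orrSommerfeldMode {U : L2T} (hU : MemLp U ⊤ tmeas)
    (hW : MemLp (deriv2 U) ⊤ tmeas)
    (hUW : ∀ n : ℤ, fourierCoeff (deriv2 U) n = -((n : ℂ) ^ 2) * fourierCoeff U n)
    {ν α : ℝ} {k : ℤ} (hν : ν ≠ 0) (hα : α ≠ 0) (hk : k ≠ 0)
    (hβ₀ : α * k ≠ 0) (hβ : (α * k) ^ 2 ≤ 1) :
    IsSimilarBy (orrSommerfeldMode U ν α k)
      (conjugatedMode hU hW (α * k) (α * k / ν))
      ((vorticityEquiv hβ₀ hβ).trans (modeEquiv k)) ν := by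
  intro h r
  have hψ (n : ℤ) : fourierCoeff (vorticity (α * k) h) n
      = modeSymbol (α * k) n * fourierCoeff (stream (α * k) h) n := by
    rw [fourierCoeff_vorticity hβ, fourierCoeff_stream, ← mul_assoc, modeSymbol_mul_streamSymbol]
  rw [orrSommerfeldMode, mem_graph_part, graph_orrSommerfeld U ν hα, Submodule.coe_smul,
    ContinuousLinearEquiv.trans_apply, ContinuousLinearEquiv.trans_apply, vorticityEquiv_apply,
    vorticityEquiv_apply, coe_modeEquiv, coe_modeEquiv, ← map_smul,
    mode_mem_graph_iff hU hW hν hα hk hψ, ← vorticity_transportOp hU hW hUW hβ, conjugatedMode,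
    mem_graph_vadd, mem_graph_unboundedMultiplier]
  refine forall_congr' fun n => ?_
  have hν' : (ν : ℂ) ≠ 0 := Complex.ofReal_ne_zero.2 hν
  have hS := vorticitySymbol_ne_zero hβ₀ n
  rw [fourierCoeff_coe_smul, fourierCoeff_vorticity hβ, fourierCoeff_vorticity hβ,
    fourierCoeff_vorticity hβ, fourierCoeff_coe_sub, ContinuousLinearMap.coe_coe,
    scaledTransport, smul_apply, fourierCoeff_coe_smul]
  push_cast
  have hdiv : (ν : ℂ) * (α * k / ν) = α * k := mul_div_cancel₀ _ hν'
  set K := fourierCoeff (transportOp hU hW (α * k) h) n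
  constructor <;> intro heq
  · refine mul_left_cancel₀ (mul_ne_zero hν' hS) ?_
    linear_combination heq + vorticitySymbol (α * k) n * Complex.I * K * hdiv
  · linear_combination ν * vorticitySymbol (α * k) n * heq
      - vorticitySymbol (α * k) n * Complex.I * K * hdiv

end Conjugation

/-! ### Bounds in terms of the `H³` norm -/

theorem hasSum_normH {s : ℕ} {U : L2T} (hU : MemH s U) :
    HasSum (fun n : ℤ => (1 + (n : ℝ) ^ 2) ^ s * ‖fourierCoeff U n‖ ^ 2) (normH s U ^ 2) := by
  rw [normH, Real.sq_sqrt (tsum_nonneg fun n => by positivity)]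
  exact hU.hasSum

theorem fourierCoeff_deriv2 {U : L2T} (hU : MemH 3 U) (n : ℤ) :
    fourierCoeff (deriv2 U) n = -((n : ℂ) ^ 2) * fourierCoeff U n := by
  rw [deriv2, fourierCoeff_ofCoeff]
  refine memℓp_gen ?_
  simp only [ENNReal.toReal_ofNat, Real.rpow_ofNat]
  refine Summable.of_nonneg_of_le (fun n => by positivity) (fun n => ?_) hU
  rw [norm_mul, norm_neg, norm_pow, Complex.norm_intCast, sq_abs, mul_pow]
  refine mul_le_mul_of_nonneg_right ?_ (by positivity)
  calc ((n : ℝ) ^ 2) ^ 2 ≤ (1 + (n : ℝ) ^ 2) ^ 2 := by gcongr; linarith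
    _ ≤ (1 + (n : ℝ) ^ 2) ^ 3 := pow_le_pow_right₀ (by linarith [sq_nonneg (n : ℝ)]) (by norm_num)

theorem norm_inv_I_mul_intCast_le (n : ℤ) :
    ‖(if n = 0 then 0 else (Complex.I * (n : ℂ))⁻¹ : ℂ)‖ ≤ 1 := by
  split_ifs with hn
  · simp
  · rw [norm_inv, norm_mul, Complex.norm_I, one_mul, Complex.norm_intCast]
    exact inv_le_one_of_one_le₀ (by exact_mod_cast Int.one_le_abs hn)

theorem antideriv_eq_fourierMultiplier (U : L2T) : antideriv U
    = fourierMultiplier (fun n => if n = 0 then 0 else (Complex.I * (n : ℂ))⁻¹) U := by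
  refine fourierCoeff_ext fun n => ?_
  rw [fourierCoeff_fourierMultiplier norm_inv_I_mul_intCast_le,
    ← fourierCoeff_ofCoeff_mul norm_inv_I_mul_intCast_le, antideriv]
  simp only [ite_mul, zero_mul, inv_mul_eq_div]

theorem norm_antideriv_le (U : L2T) : ‖antideriv U‖ ≤ ‖U‖ := by
  rw [antideriv_eq_fourierMultiplier]
  exact ContinuousLinearMap.le_of_opNorm_le_of_le _
    (norm_fourierMultiplier_le norm_inv_I_mul_intCast_le) le_rfl |>.trans_eq (one_mul _)

theorem norm_fourierCoeff_antideriv_sq (U : L2T) (n : ℤ) :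
    ‖fourierCoeff (antideriv U) n‖ ^ 2
      = if n = 0 then 0 else ((n : ℝ) ^ 2)⁻¹ * ‖fourierCoeff U n‖ ^ 2 := by
  rw [antideriv_eq_fourierMultiplier, fourierCoeff_fourierMultiplier norm_inv_I_mul_intCast_le]
  split_ifs
  · simp
  · rw [norm_mul, norm_inv, norm_mul, Complex.norm_I, one_mul, Complex.norm_intCast, mul_pow,
      inv_pow, sq_abs]

theorem summable_inv_one_add_sq : Summable fun n : ℤ => (1 + (n : ℝ) ^ 2)⁻¹ := by
  refine Summable.of_norm_bounded_eventually (Real.summable_one_div_int_pow.2 one_lt_two) ?_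
  filter_upwards [(Set.finite_singleton (0 : ℤ)).compl_mem_cofinite] with n hn
  have hsq := one_le_sq_intCast hn
  rw [Real.norm_of_nonneg (by positivity), one_div]
  exact inv_anti₀ (by linarith) (by linarith)

theorem ae_norm_le_tsum_norm_fourierCoeff {W : L2T} (h : Summable fun n => ‖fourierCoeff W n‖) :
    ∀ᵐ y ∂tmeas, ‖W y‖ ≤ ∑' n, ‖fourierCoeff W n‖ := by
  have hn (n : ℤ) : ‖fourierCoeff W n • (fourier n : C(Torus, ℂ))‖ = ‖fourierCoeff W n‖ := by
    rw [norm_smul, fourier_norm, mul_one]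
  simp only [← hn] at h ⊢
  set F : C(Torus, ℂ) := ∑' n, fourierCoeff W n • fourier n
  have hF : ContinuousMap.toLp (E := ℂ) 2 tmeas ℂ F = W := by
    refine ((ContinuousMap.toLp (E := ℂ) 2 tmeas ℂ).hasSum h.of_norm.hasSum).unique ?_
    convert hasSum_fourier_series_L2 W using 2 with n
    simp only [map_smul]
  have hcoe := ContinuousMap.coeFn_toLp (p := 2) (𝕜 := ℂ) tmeas F
  rw [hF] at hcoe
  filter_upwards [hcoe] with y hy
  rw [hy]
  exact (F.norm_coe_le_norm y).trans (norm_tsum_le_tsum_norm h)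

/-- A bound for the suprema of `U` and `U''` in terms of a bound `M` for the `H³` norm of `U`. -/
def wienerBound (M : ℝ) : ℝ := (∑' n : ℤ, (1 + (n : ℝ) ^ 2)⁻¹ + M ^ 2) / 2

theorem half_le_wienerBound (M : ℝ) : 1 / 2 ≤ wienerBound M := by
  have hsum := summable_inv_one_add_sq.le_tsum 0 fun n _ => by positivity
  norm_num at hsum
  rw [wienerBound]
  linarith [sq_nonneg M]

theorem ae_norm_le_wienerBound {U W : L2T} {M : ℝ} (hU : MemH 3 U) (hM : normH 3 U ≤ M)
    (hW : ∀ n : ℤ, ‖fourierCoeff W n‖ ≤ (1 + (n : ℝ) ^ 2) * ‖fourierCoeff U n‖) :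
    ∀ᵐ y ∂tmeas, ‖W y‖ ≤ wienerBound M := by
  -- `a b ≤ (a⁻¹ + a³ b²) / 2` for `a = 1 + n²` and `b = |U_n|`
  have hyoung (n : ℤ) : ‖fourierCoeff W n‖ ≤ ((1 + (n : ℝ) ^ 2)⁻¹
      + (1 + (n : ℝ) ^ 2) ^ 3 * ‖fourierCoeff U n‖ ^ 2) / 2 := by
    refine (hW n).trans ?_
    set a := 1 + (n : ℝ) ^ 2
    set b := ‖fourierCoeff U n‖
    have ha : 0 < a := by positivity
    have hsq : 0 ≤ a⁻¹ * (1 - a ^ 2 * b) ^ 2 := by positivity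
    have hexpand : a⁻¹ * (1 - a ^ 2 * b) ^ 2 = a⁻¹ + a ^ 3 * b ^ 2 - 2 * (a * b) := by
      field_simp
      ring
    linarith
  have hbound := (summable_inv_one_add_sq.hasSum.add (hasSum_normH hU)).div_const 2
  have hsum : Summable fun n => ‖fourierCoeff W n‖ :=
    Summable.of_nonneg_of_le (fun n => norm_nonneg _) hyoung hbound.summable
  filter_upwards [ae_norm_le_tsum_norm_fourierCoeff hsum] with y hy
  refine hy.trans ((hasSum_le hyoung hsum.hasSum hbound).trans ?_)
  have hsq : normH 3 U ^ 2 ≤ M ^ 2 := pow_le_pow_left₀ (Real.sqrt_nonneg _) hM 2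
  rw [wienerBound]
  linarith

theorem ae_norm_le_wienerBound_self {U : L2T} {M : ℝ} (hU : MemH 3 U) (hM : normH 3 U ≤ M) :
    ∀ᵐ y ∂tmeas, ‖U y‖ ≤ wienerBound M :=
  ae_norm_le_wienerBound hU hM fun n =>
    le_mul_of_one_le_left (norm_nonneg _) (by linarith [sq_nonneg (n : ℝ)])

theorem ae_norm_deriv2_le_wienerBound {U : L2T} {M : ℝ} (hU : MemH 3 U) (hM : normH 3 U ≤ M) :
    ∀ᵐ y ∂tmeas, ‖deriv2 U y‖ ≤ wienerBound M :=
  ae_norm_le_wienerBound hU hM fun n => by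
    rw [fourierCoeff_deriv2 hU, norm_mul, norm_neg, norm_pow, Complex.norm_intCast, sq_abs]
    gcongr
    linarith

theorem norm_streamSymbol_add_inv_sq_le (β : ℝ) {n : ℤ} (hn : n ≠ 0) :
    ‖streamSymbol β n + ((((n : ℝ) ^ 2)⁻¹ : ℝ) : ℂ)‖ ≤ β ^ 2 := by
  rw [streamSymbol, if_neg hn, modeSymbol]
  have ha := one_le_sq_intCast hn
  set a := (n : ℝ) ^ 2
  have hβ := sq_nonneg β
  have hsum : (-((β ^ 2 + a : ℝ) : ℂ))⁻¹ + ((a⁻¹ : ℝ) : ℂ)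
      = ((β ^ 2 / ((β ^ 2 + a) * a) : ℝ) : ℂ) := by
    rw [inv_neg, ← Complex.ofReal_inv, ← Complex.ofReal_neg, ← Complex.ofReal_add]
    congr 1
    have : β ^ 2 + a ≠ 0 := by linarith
    field_simp
    ring
  rw [hsum, Complex.norm_real, Real.norm_of_nonneg (by positivity)]
  exact div_le_self hβ (by nlinarith)

/-- The mean of `U (∂_yy - β²)⁻¹ U` is `-‖∂_y⁻¹ U‖²` up to `O(β²)`. -/
theorem norm_mean_mul_stream_add_le {U : L2T} (hU : MemLp U ⊤ tmeas)
    (hreal : ∀ᵐ y ∂tmeas, (U y).im = 0) (hU₀ : fourierCoeff U 0 = 0) (β : ℝ) :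
    ‖fourierCoeff (mulOp U hU (stream β U)) 0 + ((‖antideriv U‖ ^ 2 : ℝ) : ℂ)‖
      ≤ β ^ 2 * ‖U‖ ^ 2 := by
  refine ((hasSum_fourierCoeff_mulOp_zero U hU (stream β U)).add (Complex.hasSum_ofReal.2
    (hasSum_norm_sq (antideriv U)))).norm_le_of_bounded
    ((hasSum_norm_sq U).mul_left (β ^ 2)) fun n => ?_
  rw [fourierCoeff_neg_of_real hreal, fourierCoeff_stream, norm_fourierCoeff_antideriv_sq]
  split_ifs with hn
  · simp [hn, hU₀]
  · have hterm : star (fourierCoeff U n) * (streamSymbol β n * fourierCoeff U n)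
        + ((((n : ℝ) ^ 2)⁻¹ * ‖fourierCoeff U n‖ ^ 2 : ℝ) : ℂ)
        = (streamSymbol β n + ((((n : ℝ) ^ 2)⁻¹ : ℝ) : ℂ)) * (‖fourierCoeff U n‖ : ℂ) ^ 2 := by
      rw [mul_left_comm, ← starRingEnd_apply, Complex.conj_mul', Complex.ofReal_mul,
        Complex.ofReal_pow, add_mul]
    rw [hterm, norm_mul, norm_pow, Complex.norm_real, norm_norm]
    exact mul_le_mul_of_nonneg_right (norm_streamSymbol_add_inv_sq_le β hn) (sq_nonneg _)

/-! ### The spectrum of the conjugated operator -/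

theorem re_modeSymbol (β : ℝ) (n : ℤ) : (modeSymbol β n).re = -(β ^ 2 + (n : ℝ) ^ 2) := by
  rw [modeSymbol, Complex.neg_re, Complex.ofReal_re]

theorem re_sub_re_modeSymbol_le (β : ℝ) (n : ℤ) (z : ℂ) :
    z.re + (n : ℝ) ^ 2 ≤ ‖modeSymbol β n - z‖ := by
  rw [norm_sub_rev]
  refine le_trans ?_ ((le_abs_self _).trans (Complex.abs_re_le_norm _))
  rw [Complex.sub_re, re_modeSymbol]
  linarith [sq_nonneg β]

theorem isSpectralSplitting_modeSymbol (β : ℝ) :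
    IsSpectralSplitting (unboundedMultiplier (modeSymbol β)) (modeSymbol β 0) constOne (coeffL 0)
      {z | -(1 / 2) < z.re} (reducedResolvent (modeSymbol β) 0) 2 :=
  isSpectralSplitting_unboundedMultiplier two_pos fun z (hz : -(1 / 2) < z.re) n hn => by
    linarith [re_sub_re_modeSymbol_le β n z, one_le_sq_intCast hn]

theorem one_add_sq_le_norm_modeSymbol_sub_one (β : ℝ) (n : ℤ) :
    1 + (n : ℝ) ^ 2 ≤ ‖modeSymbol β n - 1‖ := by
  simpa only [Complex.one_re] using re_sub_re_modeSymbol_le β n 1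

theorem norm_inv_modeSymbol_sub_one_le (β : ℝ) (n : ℤ) :
    ‖(modeSymbol β n - 1)⁻¹‖ ≤ (1 + (n : ℝ) ^ 2)⁻¹ := by
  rw [norm_inv]
  exact inv_anti₀ (by positivity) (one_add_sq_le_norm_modeSymbol_sub_one β n)

theorem isEigenvalue_of_mem_spec_vadd_modeSymbol {B : L2T →L[ℂ] L2T} (hB : ‖B‖ < 1) {β : ℝ} {z : ℂ}
    (hz : z ∈ spec ((B : L2T →ₗ[ℂ] L2T) +ᵥ unboundedMultiplier (modeSymbol β))) :
    IsEigenvalue ((B : L2T →ₗ[ℂ] L2T) +ᵥ unboundedMultiplier (modeSymbol β)) z := by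
  have hbound (n : ℤ) : ‖(modeSymbol β n - 1)⁻¹‖ ≤ 1 :=
    (norm_inv_modeSymbol_sub_one_le β n).trans
      (inv_le_one_of_one_le₀ (by linarith [sq_nonneg (n : ℝ)]))
  have hne (n : ℤ) : modeSymbol β n ≠ 1 := fun h => by
    have := one_add_sq_le_norm_modeSymbol_sub_one β n
    rw [h, sub_self, norm_zero] at this
    linarith [sq_nonneg (n : ℝ)]
  have hcompact := isCompactOperator_fourierMultiplier
    (squeeze_zero_norm (norm_inv_modeSymbol_sub_one_le β)
      summable_inv_one_add_sq.tendsto_cofinite_zero)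
  obtain ⟨R, hR, hRc⟩ := exists_compact_isResolvent_vadd
    (isResolvent_unboundedMultiplier hne hbound) hcompact
    ((mul_le_of_le_one_right (norm_nonneg B) (norm_fourierMultiplier_le hbound)).trans_lt hB)
  exact isEigenvalue_of_mem_spec hR hRc hz

/-! ### Asymptotics of the leading eigenvalue -/

section Asymptotics

variable {U W : L2T} (hU : MemLp U ⊤ tmeas) (hW : MemLp W ⊤ tmeas) (β ε : ℝ)

/-- The leading eigenvalue of `conjugatedMode` if `1 + g` is the corresponding eigenvector. -/
def modeEigenvalue (g : L2T) : ℂ :=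
  perturbedEigenvalue (modeSymbol β 0) constOne (coeffL 0) (scaledTransport hU hW β ε) g

/-- `g` is a small fixed point of `correctionMap`, so that `1 + g` is the eigenvector of
`conjugatedMode` for the eigenvalue `modeEigenvalue g`. -/
structure IsModeCorrection (g : L2T) : Prop where
  norm_le : ‖g‖ ≤ 1 / 3
  fixed : correctionMap (modeSymbol β 0) constOne (coeffL 0) (reducedResolvent (modeSymbol β) 0)
    (scaledTransport hU hW β ε) g = g

variable {β ε}

theorem norm_scaledTransport_le {κ : ℝ} (hT : ‖transportOp hU hW β‖ ≤ κ) :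
    ‖scaledTransport hU hW β ε‖ ≤ κ * |ε| := by
  rw [scaledTransport, norm_smul, norm_neg, norm_mul, Complex.norm_I, one_mul, Complex.norm_real,
    Real.norm_eq_abs, mul_comm]
  gcongr

section Regime

variable {g : L2T} {κ : ℝ} (hT : ‖transportOp hU hW β‖ ≤ κ) (hε : κ * |ε| ≤ 1 / 8)
  (hβε : |β| ≤ κ * |ε|)

section

include hε hβε

theorem sq_le_of_abs_le : β ^ 2 ≤ 1 / 8 * (κ * |ε|) := by
  rw [← sq_abs, sq]
  exact mul_le_mul (hβε.trans hε) hβε (abs_nonneg β) (by norm_num)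

theorem sq_le_one_of_abs_le : β ^ 2 ≤ 1 := by
  linarith [sq_le_of_abs_le hε hβε]

include hT

theorem closedBall_subset_re_gt :
    Metric.closedBall (modeSymbol β 0) (4 / 3 * ‖scaledTransport hU hW β ε‖)
      ⊆ {z : ℂ | -(1 / 2) < z.re} := fun z hz => by
  have hre := (abs_le.1 ((Complex.abs_re_le_norm _).trans (mem_closedBall_iff_norm.1 hz))).1
  rw [Complex.sub_re, re_modeSymbol, Int.cast_zero] at hre
  have := norm_scaledTransport_le (ε := ε) hU hW hT
  have := sq_le_of_abs_le hε hβε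
  exact Set.mem_ofPred_eq ▸ by linarith

end

theorem modeEigenvalue_eq (hβ : β ^ 2 ≤ 1)
    (hUW : ∀ n : ℤ, fourierCoeff W n = -((n : ℂ) ^ 2) * fourierCoeff U n)
    (hU₀ : fourierCoeff U 0 = 0) (g : L2T) : modeEigenvalue hU hW β ε g
      = modeSymbol β 0 - Complex.I * ε * fourierCoeff (transportOp hU hW β g) 0 := by
  rw [modeEigenvalue, perturbedEigenvalue, scaledTransport, smul_apply, coeffL_apply, map_add,
    fourierCoeff_coe_smul, fourierCoeff_coe_add, fourierCoeff_transportOp_constOne hU hW hUW hU₀ hβ,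
    hU₀]
  ring

namespace IsModeCorrection

variable {hU hW} (hg : IsModeCorrection hU hW β ε g)
include hg

theorem eq_smul_reducedResolvent : g = (Complex.I * ε) •
    reducedResolvent (modeSymbol β) 0 (modeEigenvalue hU hW β ε g)
      (transportOp hU hW β (constOne + g)) := by
  have h := hg.fixed.symm
  rwa [correctionMap, scaledTransport, smul_apply, map_smul, neg_smul, neg_neg] at h

include hT

theorem norm_eigenvalue_sub_le : ‖modeEigenvalue hU hW β ε g - modeSymbol β 0‖
    ≤ 4 / 3 * (κ * |ε|) := by
  have h := mem_closedBall_iff_norm.1 <| (isSpectralSplitting_modeSymbol β).perturbedEigenvalue_mem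
    (B := scaledTransport hU hW β ε) hg.norm_le
  exact h.trans (by gcongr; exact norm_scaledTransport_le hU hW hT)

include hε hβε

theorem re_eigenvalue_gt : -(1 / 2) < (modeEigenvalue hU hW β ε g).re :=
  closedBall_subset_re_gt hU hW hT hε hβε
    ((isSpectralSplitting_modeSymbol β).perturbedEigenvalue_mem hg.norm_le)

theorem norm_reducedResolvent_apply_le (f : L2T) :
    ‖reducedResolvent (modeSymbol β) 0 (modeEigenvalue hU hW β ε g) f‖ ≤ 2 * ‖f‖ :=
  (isSpectralSplitting_modeSymbol β).norm_resolvent_apply_le (hg.re_eigenvalue_gt hT hε hβε) f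

theorem fourierCoeff_zero : fourierCoeff g 0 = 0 :=
  coeffL_apply 0 g ▸ (isSpectralSplitting_modeSymbol β).apply_fixedPoint
    (closedBall_subset_re_gt hU hW hT hε hβε) hg.norm_le hg.fixed

theorem norm_le_mul_abs : ‖g‖ ≤ 8 / 3 * (κ * |ε|) := by
  have hadd := (isSpectralSplitting_modeSymbol β).norm_self_add_le hg.norm_le
  rw [hg.eq_smul_reducedResolvent, norm_smul, norm_mul, Complex.norm_I, one_mul,
    Complex.norm_real, Real.norm_eq_abs]
  calc _ ≤ |ε| * (2 * (κ * (4 / 3))) := by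
        gcongr
        refine (hg.norm_reducedResolvent_apply_le hT hε hβε _).trans ?_
        gcongr
        exact ContinuousLinearMap.le_of_opNorm_le_of_le _ hT hadd
    _ = _ := by ring

variable (hUκ : ‖U‖ ≤ κ) (hUW : ∀ n : ℤ, fourierCoeff W n = -((n : ℂ) ^ 2) * fourierCoeff U n)
  (hU₀ : fourierCoeff U 0 = 0)

include hUW hU₀

/-- `U` lies in the domain of `A = ∂_yy - β²` and `transportOp 1 = -2 β² U - A U`, so the reduced
resolvent recovers `-U` from it. -/
theorem add_smul_eq : g + (Complex.I * ε) • U = (Complex.I * ε) •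
    reducedResolvent (modeSymbol β) 0 (modeEigenvalue hU hW β ε g)
      (transportOp hU hW β g + (2 * modeSymbol β 0 - modeEigenvalue hU hW β ε g) • U) := by
  have hgraph : (U, (2 * modeSymbol β 0) • U - transportOp hU hW β constOne) ∈
      (unboundedMultiplier (modeSymbol β)).graph := by
    refine mem_graph_unboundedMultiplier.2 fun n => ?_
    rw [fourierCoeff_coe_sub, fourierCoeff_coe_smul,
      fourierCoeff_transportOp_constOne hU hW hUW hU₀ (sq_le_one_of_abs_le hε hβε)]
    ring
  have hR := (isSpectralSplitting_modeSymbol β).resolvent_sub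
    (hg.re_eigenvalue_gt hT hε hβε) hgraph
  rw [coeffL_apply, hU₀, zero_smul, sub_zero] at hR
  refine (congrArg₂ (· + ·) hg.eq_smul_reducedResolvent
    (congrArg ((Complex.I * (ε : ℂ)) • ·) hR.symm)).trans ?_
  rw [← smul_add, ← map_add, map_add (transportOp hU hW β), sub_smul]
  congr 2
  abel

include hUκ

theorem norm_add_smul_le : ‖g + (Complex.I * ε) • U‖ ≤ 9 * (κ * |ε|) ^ 2 := by
  have hκ : 0 ≤ κ := (norm_nonneg _).trans hUκ
  have hcoef : ‖2 * modeSymbol β 0 - modeEigenvalue hU hW β ε g‖ ≤ 35 / 24 * (κ * |ε|) := by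
    have hσ : ‖modeSymbol β 0‖ ≤ 1 / 8 * (κ * |ε|) := by
      simpa [norm_modeSymbol] using sq_le_of_abs_le hε hβε
    rw [two_mul, add_sub_assoc, ← neg_sub (modeEigenvalue hU hW β ε g), ← sub_eq_add_neg]
    exact (norm_sub_le_of_le hσ (hg.norm_eigenvalue_sub_le hT)).trans_eq (by ring)
  rw [hg.add_smul_eq hT hε hβε hUW hU₀, norm_smul, norm_mul, Complex.norm_I, one_mul,
    Complex.norm_real, Real.norm_eq_abs]
  calc _ ≤ |ε| * (2 * (κ * (8 / 3 * (κ * |ε|)) + 35 / 24 * (κ * |ε|) * κ)) := by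
        gcongr
        refine (hg.norm_reducedResolvent_apply_le hT hε hβε _).trans ?_
        gcongr
        refine norm_add_le_of_le
          (ContinuousLinearMap.le_of_opNorm_le_of_le _ hT (hg.norm_le_mul_abs hT hε hβε)) ?_
        rw [norm_smul]
        gcongr
    _ = 33 / 4 * (κ * |ε|) ^ 2 := by ring
    _ ≤ 9 * (κ * |ε|) ^ 2 := by gcongr; norm_num

theorem norm_eigenvalue_sub_expansion_le (hreal : ∀ᵐ y ∂tmeas, (U y).im = 0) :
    ‖modeEigenvalue hU hW β ε g - ((ε ^ 2 * ‖antideriv U‖ ^ 2 - β ^ 2 : ℝ) : ℂ)‖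
      ≤ 10 * (κ * |ε|) ^ 3 := by
  have hκ : 0 ≤ κ := (norm_nonneg _).trans hUκ
  set d := g + (Complex.I * ε) • U with hd
  have hsplit : modeEigenvalue hU hW β ε g - ((ε ^ 2 * ‖antideriv U‖ ^ 2 - β ^ 2 : ℝ) : ℂ)
      = -(Complex.I * ε * fourierCoeff (transportOp hU hW β d) 0
        + ε ^ 2 * (fourierCoeff (mulOp U hU (stream β U)) 0
          + ((‖antideriv U‖ ^ 2 : ℝ) : ℂ))) := by
    rw [modeEigenvalue_eq hU hW (sq_le_one_of_abs_le hε hβε) hUW hU₀, hd, map_add, map_smul,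
      fourierCoeff_coe_add, fourierCoeff_coe_smul, fourierCoeff_transportOp_zero hU hW β U,
      modeSymbol]
    push_cast
    linear_combination ((ε ^ 2 : ℂ) * fourierCoeff (mulOp U hU (stream β U)) 0) * Complex.I_sq
  have hd_le : ‖fourierCoeff (transportOp hU hW β d) 0‖ ≤ κ * (9 * (κ * |ε|) ^ 2) :=
    (norm_fourierCoeff_le _ 0).trans (ContinuousLinearMap.le_of_opNorm_le_of_le _ hT
      (hg.norm_add_smul_le hT hε hβε hUκ hUW hU₀))
  have hmean : ‖fourierCoeff (mulOp U hU (stream β U)) 0 + ((‖antideriv U‖ ^ 2 : ℝ) : ℂ)‖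
      ≤ 1 / 8 * (κ * |ε|) * κ ^ 2 :=
    (norm_mean_mul_stream_add_le hU hreal hU₀ β).trans
      (by gcongr; exact sq_le_of_abs_le hε hβε)
  rw [hsplit, norm_neg]
  calc _ ≤ |ε| * (κ * (9 * (κ * |ε|) ^ 2)) + |ε| ^ 2 * (1 / 8 * (κ * |ε|) * κ ^ 2) := by
        refine norm_add_le_of_le ?_ ?_
        · rw [norm_mul, norm_mul, Complex.norm_I, one_mul, Complex.norm_real, Real.norm_eq_abs]
          gcongr
        · rw [norm_mul, norm_pow, Complex.norm_real, Real.norm_eq_abs]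
          gcongr
    _ = 73 / 8 * (κ * |ε|) ^ 3 := by ring
    _ ≤ 10 * (κ * |ε|) ^ 3 := by gcongr; norm_num

theorem norm_vorticity_sub_le (hε₀ : ε ≠ 0) :
    ‖vorticity β ((Complex.I / ε) • (constOne + g)) - U‖ ≤ 10 * (κ ^ 2 * |ε|) := by
  have hε' : (ε : ℂ) ≠ 0 := Complex.ofReal_ne_zero.2 hε₀
  have hβ := sq_le_one_of_abs_le hε hβε
  have hsplit : vorticity β ((Complex.I / ε) • (constOne + g)) - U
      = (Complex.I / ε) • (modeSymbol β 0 • constOne + (g + (Complex.I * ε) • U)) := by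
    rw [map_smul, map_add, vorticity_constOne hβ,
      vorticity_of_meanFree hβ (hg.fourierCoeff_zero hT hε hβε), ← add_assoc, smul_add _ _ (_ • U),
      smul_smul, div_mul_eq_mul_div, ← mul_assoc, Complex.I_mul_I, neg_one_mul, neg_div,
      div_self hε', neg_one_smul, sub_eq_add_neg]
  have hconst : ‖modeSymbol β 0 • constOne‖ ≤ (κ * |ε|) ^ 2 := by
    rw [norm_smul, norm_constOne, mul_one, norm_modeSymbol, Int.cast_zero, zero_pow two_ne_zero,
      add_zero, ← sq_abs]
    gcongr
  rw [hsplit, norm_smul, norm_div, Complex.norm_I, Complex.norm_real, Real.norm_eq_abs]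
  calc _ ≤ 1 / |ε| * ((κ * |ε|) ^ 2 + 9 * (κ * |ε|) ^ 2) := by
        gcongr
        exact norm_add_le_of_le hconst (hg.norm_add_smul_le hT hε hβε hUκ hUW hU₀)
    _ = 10 * (κ ^ 2 * |ε|) := by
        have : |ε| ≠ 0 := abs_ne_zero.2 hε₀
        field_simp
        ring

end IsModeCorrection

theorem exists_isModeCorrection (hT : ‖transportOp hU hW β‖ ≤ κ) (hε : κ * |ε| ≤ 1 / 8)
    (hβε : |β| ≤ κ * |ε|) : ∃ g, IsModeCorrection hU hW β ε g ∧
      IsEigenvector (conjugatedMode hU hW β ε) (modeEigenvalue hU hW β ε g) (constOne + g) ∧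
      IsSimpleEigenvalue (conjugatedMode hU hW β ε) (modeEigenvalue hU hW β ε g) ∧
      ∀ z ∈ spec (conjugatedMode hU hW β ε), IsEigenvalue (conjugatedMode hU hW β ε) z ∧
        (z ≠ modeEigenvalue hU hW β ε g → z.re ≤ -(1 / 2)) := by
  have hB := norm_scaledTransport_le (ε := ε) hU hW hT
  obtain ⟨g, hg, hfix, hv, hsimple, huniq⟩ :=
    (isSpectralSplitting_modeSymbol β).exists_isSimpleEigenvalue
      (closedBall_subset_re_gt hU hW hT hε hβε) (by linarith)
  refine ⟨g, ⟨hg, hfix⟩, hv, hsimple, fun z hz => ?_⟩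
  have hz' := isEigenvalue_of_mem_spec_vadd_modeSymbol (by linarith) hz
  exact ⟨hz', fun hne => not_lt.1 fun hre => hne (huniq z hre hz')⟩

end Regime
end Asymptotics

/-! ### The leading eigenvalue of the Orr–Sommerfeld operator on a mode -/

section LeadingEigenvalue

variable {U : L2T} {M : ℝ} (hU₃ : MemH 3 U) (hUM : normH 3 U ≤ M)
include hU₃ hUM

theorem norm_le_wienerBound : ‖U‖ ≤ wienerBound M := by
  have hbound := ae_norm_le_wienerBound_self hU₃ hUM
  have hU := memLp_top_of_bound (Lp.aestronglyMeasurable U) _ hbound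
  have hle := (mulOp U hU).le_of_opNorm_le
    (norm_mulOp_le hU (by linarith [half_le_wienerBound M]) hbound) constOne
  rwa [mulOp_constOne, norm_constOne, mul_one] at hle

theorem norm_transportOp_deriv2_le (hU : MemLp U ⊤ tmeas) (hW : MemLp (deriv2 U) ⊤ tmeas) {β : ℝ}
    (hβ : β ^ 2 ≤ 1) : ‖transportOp hU hW β‖ ≤ 3 * wienerBound M :=
  norm_transportOp_le hU hW
    (norm_mulOp_le hU (by linarith [half_le_wienerBound M]) (ae_norm_le_wienerBound_self hU₃ hUM))
    (norm_mulOp_le hW (by linarith [half_le_wienerBound M])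
      (ae_norm_deriv2_le_wienerBound hU₃ hUM)) hβ

theorem exists_leading_eigenvalue (hreal : ∀ᵐ y ∂tmeas, (U y).im = 0) (hU₀ : fourierCoeff U 0 = 0)
    {ν α κ : ℝ} {k : ℤ} (hκ : κ = 3 * wienerBound M) (hν : 0 < ν) (hα : α ≠ 0) (hk : k ≠ 0)
    (hνU : ν ≤ ‖antideriv U‖) (hε : κ * |α * k / ν| ≤ 1 / 8) :
    ∃ (μ : ℂ) (V : L2T), IsEigenvector (orrSommerfeldMode U ν α k) (ν * μ) (modeElem k V) ∧
      IsSimpleEigenvalue (orrSommerfeldMode U ν α k) (ν * μ) ∧ -(1 / 2) < μ.re ∧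
      (∀ z ∈ spec (orrSommerfeldMode U ν α k), z ≠ ν * μ →
        IsEigenvalue (orrSommerfeldMode U ν α k) z ∧ z.re ≤ -(ν / 2)) ∧
      ‖μ - (((α * k / ν) ^ 2 * ‖antideriv U‖ ^ 2 - (α * k) ^ 2 : ℝ) : ℂ)‖
        ≤ 10 * (κ * |α * k / ν|) ^ 3 ∧
      ‖V - U‖ ≤ 10 * (κ ^ 2 * |α * k / ν|) := by
  have hU := memLp_top_of_bound (Lp.aestronglyMeasurable U) _ (ae_norm_le_wienerBound_self hU₃ hUM)
  have hW := memLp_top_of_bound (Lp.aestronglyMeasurable (deriv2 U)) _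
    (ae_norm_deriv2_le_wienerBound hU₃ hUM)
  have hUW := fourierCoeff_deriv2 hU₃
  have hUκ : ‖U‖ ≤ κ := by linarith [norm_le_wienerBound hU₃ hUM, half_le_wienerBound M]
  have hβ₀ : α * k ≠ 0 := mul_ne_zero hα (Int.cast_ne_zero.2 hk)
  have hβε : |α * k| ≤ κ * |α * k / ν| := by
    rw [abs_div, abs_of_pos hν, mul_div_left_comm]
    exact le_mul_of_one_le_right (abs_nonneg _)
      ((one_le_div hν).2 (hνU.trans ((norm_antideriv_le U).trans hUκ)))
  have hβ := sq_le_one_of_abs_le hε hβε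
  have hT : ‖transportOp hU hW (α * k)‖ ≤ κ := hκ ▸ norm_transportOp_deriv2_le hU₃ hUM hU hW hβ
  obtain ⟨g, hg, hv, hsimple, hspec⟩ := exists_isModeCorrection hU hW hT hε hβε
  have hsim := isSimilarBy_orrSommerfeldMode hU hW hUW hν.ne' hα hk hβ₀ hβ
  have hν' : (ν : ℂ) ≠ 0 := Complex.ofReal_ne_zero.2 hν.ne'
  have hε₀ : α * k / ν ≠ 0 := div_ne_zero hβ₀ hν.ne'
  refine ⟨_, _, hsim.isEigenvector_iff.2 (isEigenvector_smul
      (div_ne_zero Complex.I_ne_zero (Complex.ofReal_ne_zero.2 hε₀)) hv),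
    hsim.isSimpleEigenvalue hν' hsimple, hg.re_eigenvalue_gt hT hε hβε, fun z hz hne => ?_,
    hg.norm_eigenvalue_sub_expansion_le hT hε hβε hUκ hUW hU₀ hreal,
    hg.norm_vorticity_sub_le hT hε hβε hUκ hUW hU₀ hε₀⟩
  obtain ⟨z, rfl⟩ : ∃ w, z = ν * w := ⟨z / ν, (mul_div_cancel₀ z hν').symm⟩
  obtain ⟨heig, hre⟩ := hspec z fun h => hz (hsim.inResolventSet hν' h)
  refine ⟨hsim.isEigenvalue_iff.2 heig, ?_⟩
  rw [Complex.re_ofReal_mul]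
  nlinarith [hre fun h => hne (congrArg ((ν : ℂ) * ·) h)]

end LeadingEigenvalue

theorem norm_mul_sub_expansion_le {ν β κ N : ℝ} {μ : ℂ} (hν : 0 < ν)
    (hμ : ‖μ - (((β / ν) ^ 2 * N ^ 2 - β ^ 2 : ℝ) : ℂ)‖ ≤ 10 * (κ * |β / ν|) ^ 3) :
    ‖ν * μ - ((β ^ 2 / ν * (N ^ 2 - ν ^ 2) : ℝ) : ℂ)‖ ≤ 10 * κ ^ 3 * (|β| ^ 3 / ν ^ 2) := by
  have hcenter : β ^ 2 / ν * (N ^ 2 - ν ^ 2) = ν * ((β / ν) ^ 2 * N ^ 2 - β ^ 2) := by field_simp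
  rw [hcenter, Complex.ofReal_mul, ← mul_sub, norm_mul, Complex.norm_real,
    Real.norm_of_nonneg hν.le]
  calc _ ≤ ν * (10 * (κ * |β / ν|) ^ 3) := by gcongr
    _ = _ := by rw [abs_div, abs_of_pos hν]; field_simp

theorem re_pos_of_norm_sub_expansion_le {ν β C D : ℝ} {lam : ℂ} (hν : 0 < ν) (hβ : β ≠ 0)
    (hlam : ‖lam - ((β ^ 2 / ν * D : ℝ) : ℂ)‖ ≤ C * (|β| ^ 3 / ν ^ 2))
    (hD : C * (|β| / ν) < D) : 0 < lam.re := by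
  have hre := (abs_le.1 ((Complex.abs_re_le_norm _).trans hlam)).1
  have hscale : C * (|β| ^ 3 / ν ^ 2) = β ^ 2 / ν * (C * (|β| / ν)) := by
    rw [← sq_abs β]; field_simp
  have hpos : 0 < β ^ 2 / ν := by positivity
  rw [Complex.sub_re, Complex.ofReal_re, hscale] at hre
  linarith [mul_lt_mul_of_pos_left hD hpos]

end OrrSommerfeld

end

open OrrSommerfeld in
theorem theorem1p1 (M : ℝ) :
    ∃ δ₀ C : ℝ, 0 < δ₀ ∧ δ₀ < 1 ∧ 1 ≤ C ∧
      ∀ U : OrrSommerfeld.L2T,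
        (∀ᵐ y ∂OrrSommerfeld.tmeas, (U y).im = 0) →
        OrrSommerfeld.MemH 3 U → OrrSommerfeld.normH 3 U ≤ M →
        ∫ y, U y ∂OrrSommerfeld.tmeas = 0 →
        ∀ (ν α : ℝ) (k : ℤ), 0 < ν → 0 < α → k ≠ 0 →
          ν < ‖OrrSommerfeld.antideriv U‖ → α * |(k : ℝ)| ≤ δ₀ * ν →
          ∃ (lam : ℂ) (V : OrrSommerfeld.L2T),
            OrrSommerfeld.IsEigenvector (OrrSommerfeld.orrSommerfeldMode U ν α k) lam
              (OrrSommerfeld.modeElem k V) ∧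
            OrrSommerfeld.IsSimpleEigenvalue (OrrSommerfeld.orrSommerfeldMode U ν α k) lam ∧
            -(ν / 2) < lam.re ∧
            (∀ z ∈ OrrSommerfeld.spec (OrrSommerfeld.orrSommerfeldMode U ν α k), z ≠ lam →
              OrrSommerfeld.IsEigenvalue (OrrSommerfeld.orrSommerfeldMode U ν α k) z ∧
              z.re ≤ -(ν / 2)) ∧
            ‖lam - (((α * k) ^ 2 / ν * (‖OrrSommerfeld.antideriv U‖ ^ 2 - ν ^ 2) : ℝ) : ℂ)‖
              ≤ C * ((α * |(k : ℝ)|) ^ 3 / ν ^ 2) ∧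
            ‖V - U‖ ≤ C * (α * |(k : ℝ)| / ν) ∧
            (C * (α * |(k : ℝ)| / ν) < ‖OrrSommerfeld.antideriv U‖ ^ 2 - ν ^ 2 → 0 < lam.re) := by
  have hw := half_le_wienerBound M
  obtain ⟨κ, hκ⟩ : ∃ κ, κ = 3 * wienerBound M := ⟨_, rfl⟩
  have hκ₁ : 1 ≤ κ := by linarith
  have hκ₃ : κ ^ 2 ≤ κ ^ 3 := pow_le_pow_right₀ hκ₁ (by norm_num)
  refine ⟨1 / (8 * κ), 10 * κ ^ 3, by positivity, (div_lt_one (by positivity)).2 (by linarith),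
    by linarith [one_le_pow₀ hκ₁ (n := 3)], fun U hreal hU₃ hUM hmean ν α k hν hα hk hνU hβ => ?_⟩
  have hαk : α * |(k : ℝ)| = |α * k| := by rw [abs_mul, abs_of_pos hα]
  have hdiv : |α * k| / ν = |α * k / ν| := by rw [abs_div, abs_of_pos hν]
  rw [hαk] at hβ ⊢
  have hε : κ * |α * k / ν| ≤ 1 / 8 := by
    have hle := (le_div_iff₀ (by positivity)).1 ((div_le_iff₀ hν).2 hβ)
    rw [hdiv] at hle
    linarith
  obtain ⟨μ, V, hV, hsimple, hμ, hspec, hexp, hVU⟩ := exists_leading_eigenvalue hU₃ hUM hreal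
    ((fourierCoeff_zero_eq_integral U).trans hmean) hκ hν hα.ne' hk hνU.le hε
  have hlam := norm_mul_sub_expansion_le hν hexp
  refine ⟨ν * μ, V, hV, hsimple, ?_, hspec, hlam, ?_,
    re_pos_of_norm_sub_expansion_le hν (mul_ne_zero hα.ne' (Int.cast_ne_zero.2 hk)) hlam⟩
  · rw [Complex.re_ofReal_mul]
    nlinarith
  · rw [hdiv]
    nlinarith [abs_nonneg (α * k / ν)]
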